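/- Let $K$ be a field, $Q$ a finite quiver with $n$ vertices, $J$ the ideal of the path algebra $KQ$ generated by the arrows, and $A = KQ/J^2$. Modules are finitely generated right $A$-modules, and $\Omega^m$, $\Omega^{-m}$ denote the $m$-th syzygy and cosyzygy with respect to minimal projective resolutions and minimal injective coresolutions. Let $K_0$ be the abelian group generated by the symbols $[M]$, one for each isomorphism class of modules, with the relations $[M]=[M']+[M'']$ whenever $M\cong M'\oplus M''$, and $[P]=0$ for $P$ projective. Let $\overline{\Omega}$ be the endomorphism of $K_0$ with $\overline{\Omega}[M]=[\Omega M]$. For a module $M$, let $\langle \mathrm{add}\,M\rangle\subseteq K_0$ be the subgroup generated by the classes of the indecomposable direct summands of $M$, let $\phi(M)$ be the least $l\in\mathbb{N}$ such that $\overline{\Omega}$ is injective on $\overline{\Omega}^{\,l+s}\langle \mathrm{add}\,M\rangle$ for all $s\in\mathbb{N}$, and let $\phi\dim(A)=\sup_M\phi(M)$. The heart of $Q$ is the full subquiver on the vertices whose simple modules lie both in the support of $\Omega^n(A_0)$ and in the support of $\Omega^{-n}(A_0)$, where $A_0=KQ/J$. The member of $Q$ is the full subquiver on the remaining vertices, and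 $Q$ is memberless if its member is empty. A final (respectively initial) subheart of $Q$ is a minimal element of the family of nonempty full subquivers of $Q$ closed under successors (respectively predecessors). It is proper if it is not all of $Q$. Then: 1. If $\phi\dim(A)=n$, then $Q$ is strongly connected, i.e. for any two vertices $a,b$ there is a (possibly trivial) path from $a$ to $b$. 2. If $Q$ is memberless and has a proper final or a proper initial subheart, then $\phi\dim(A)<n$. -/

import Mathlib

universe u v w

section PathAlgebra

open Quiver

/-- Concatenation of paths, extended bilinearly to formal linear combinations. -/
noncomputable def pathMul (K : Type u) [Field K] {V : Type v} [Quiver.{w} V] (a b c : V) :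
    (Path a b →₀ K) →ₗ[K] (Path b c →₀ K) →ₗ[K] (Path a c →₀ K) :=
  Finsupp.linearCombination K fun p => Finsupp.lmapDomain K K fun q => p.comp q

theorem pathMul_single (K : Type u) [Field K] {V : Type v} [Quiver.{w} V] {a b c : V}
    (p : Path a b) (q : Path b c) (r s : K) :
    pathMul K a b c (Finsupp.single p r) (Finsupp.single q s) =
      Finsupp.single (p.comp q) (r * s) := by
  simp [pathMul]

/-- The path algebra of a quiver with vertex set `V`: the vector space on the set of all paths,
an element being stored as the family of its components, one for each pair (source, target). -/
def PathAlgebra (K : Type u) [Field K] (V : Type v) [Quiver.{w} V] : Type (max u v w) :=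
  ∀ a b : V, Path a b →₀ K

namespace PathAlgebra

variable (K : Type u) [Field K] (V : Type v) [Quiver.{w} V]

noncomputable instance : AddCommGroup (PathAlgebra K V) :=
  inferInstanceAs (AddCommGroup (∀ a b : V, Path a b →₀ K))

noncomputable instance : Module K (PathAlgebra K V) :=
  inferInstanceAs (Module K (∀ a b : V, Path a b →₀ K))

variable {K V}

theorem add_apply (f g : PathAlgebra K V) (a b : V) : (f + g) a b = f a b + g a b := rfl

theorem smul_apply (r : K) (f : PathAlgebra K V) (a b : V) : (r • f) a b = r • f a b := rfl

open Classical in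
/-- The inclusion into the path algebra of the subspace spanned by the paths from `a` to `b`. -/
noncomputable def incl (a b : V) : (Path a b →₀ K) →ₗ[K] PathAlgebra K V :=
  LinearMap.single K (fun a : V => ∀ b : V, Path a b →₀ K) a ∘ₗ
    LinearMap.single K (fun b : V => Path a b →₀ K) b

/-- The basis element of the path algebra given by a path. -/
noncomputable def ofPath {a b : V} (p : Path a b) : PathAlgebra K V :=
  incl a b (Finsupp.single p 1)

open Classical in
theorem incl_apply {a b : V} (g : Path a b →₀ K) (x y : V) :
    incl a b g x y =
      (Pi.single a (Pi.single b g) : ∀ a b : V, Path a b →₀ K) x y := rfl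

open Classical in
/-- The identity is the sum of the trivial paths. -/
noncomputable instance : One (PathAlgebra K V) :=
  ⟨fun a => Pi.single a (Finsupp.single Path.nil 1)⟩

open Classical in
theorem one_apply (a : V) :
    (1 : PathAlgebra K V) a = Pi.single a (Finsupp.single Path.nil 1) := rfl

theorem pathMul_assoc {a b c d : V} (f : Path a b →₀ K) (g : Path b c →₀ K) (h : Path c d →₀ K) :
    pathMul K a c d (pathMul K a b c f g) h = pathMul K a b d f (pathMul K b c d g h) := by
  induction f using Finsupp.induction_linear with
  | zero => simp
  | add f f' hf hf' => simp [hf, hf']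
  | single p r =>
    induction g using Finsupp.induction_linear with
    | zero => simp
    | add g g' hg hg' => simp [hg, hg']
    | single q s =>
      induction h using Finsupp.induction_linear with
      | zero => simp
      | add h h' hh hh' => simp only [map_add, hh, hh']
      | single t x =>
        rw [pathMul_single, pathMul_single, pathMul_single, pathMul_single, Path.comp_assoc,
          mul_assoc]

theorem nil_pathMul {a b : V} (f : Path a b →₀ K) :
    pathMul K a a b (Finsupp.single Path.nil 1) f = f := by
  induction f using Finsupp.induction_linear with
  | zero => simp
  | add f f' hf hf' => simp only [map_add, hf, hf']
  | single p r => simp [pathMul_single]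

theorem pathMul_nil {a b : V} (f : Path a b →₀ K) :
    pathMul K a b b f (Finsupp.single Path.nil 1) = f := by
  induction f using Finsupp.induction_linear with
  | zero => simp
  | add f f' hf hf' => simp only [map_add, LinearMap.add_apply, hf, hf']
  | single p r => simp [pathMul_single]

variable [Fintype V]

/-- The product of two paths is their concatenation (first the left factor) if the left path ends
where the right path starts, and zero otherwise. -/
noncomputable instance : Mul (PathAlgebra K V) :=
  ⟨fun f g a c => ∑ b, pathMul K a b c (f a b) (g b c)⟩

theorem mul_apply (f g : PathAlgebra K V) (a c : V) :
    (f * g) a c = ∑ b, pathMul K a b c (f a b) (g b c) := rfl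

noncomputable instance : Ring (PathAlgebra K V) :=
  { (inferInstance : AddCommGroup (PathAlgebra K V)) with
    mul := (· * ·)
    one := 1
    left_distrib := fun f g h => by
      funext a c
      simp [mul_apply, add_apply, Finset.sum_add_distrib]
    right_distrib := fun f g h => by
      funext a c
      simp [mul_apply, add_apply, Finset.sum_add_distrib]
    zero_mul := fun f => by
      funext a c
      show ∑ b, pathMul K a b c 0 (f b c) = 0
      simp
    mul_zero := fun f => by
      funext a c
      show ∑ b, pathMul K a b c (f a b) 0 = 0
      simp
    mul_assoc := fun f g h => by
      funext a d
      simp only [mul_apply, map_sum, LinearMap.sum_apply, pathMul_assoc]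
      exact Finset.sum_comm
    one_mul := fun f => by
      classical
      funext a c
      rw [mul_apply, Finset.sum_eq_single a]
      · rw [one_apply, Pi.single_eq_same, nil_pathMul]
      · intro b _ hb
        rw [one_apply, Pi.single_eq_of_ne hb]
        simp
      · simp
    mul_one := fun f => by
      classical
      funext a c
      rw [mul_apply, Finset.sum_eq_single c]
      · rw [one_apply, Pi.single_eq_same, pathMul_nil]
      · intro b _ hb
        rw [one_apply, Pi.single_eq_of_ne (Ne.symm hb)]
        simp
      · simp }

noncomputable instance : Algebra K (PathAlgebra K V) :=
  Algebra.ofModule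
    (fun r f g => by
      funext a c
      simp [mul_apply, smul_apply, Finset.smul_sum])
    (fun r f g => by
      funext a c
      simp [mul_apply, smul_apply, Finset.smul_sum])

variable (K V)

/-- The ideal `J` of the path algebra generated by the arrows. -/
noncomputable def arrowIdeal : TwoSidedIdeal (PathAlgebra K V) :=
  TwoSidedIdeal.span {x | ∃ (a b : V) (α : a ⟶ b), x = ofPath α.toPath}

end PathAlgebra

/-- The radical square zero algebra `KQ / J²`. -/
abbrev RadSqZero (K : Type u) [Field K] (V : Type v) [Quiver.{w} V] [Fintype V] :
    Type (max u v w) :=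
  PathAlgebra K V ⧸ (PathAlgebra.arrowIdeal K V).asIdeal * (PathAlgebra.arrowIdeal K V).asIdeal

namespace RadSqZero

theorem finite_paths (V : Type v) [Quiver.{w} V] [∀ a b : V, Finite (a ⟶ b)] (a b : V) :
    {p : Quiver.Path a b | p.length < 2}.Finite := by
  classical
  have h : {p : Quiver.Path a b | p.length < 2} ⊆
      {p | ∃ h : a = b, p = h ▸ Quiver.Path.nil} ∪
        Set.range (fun α : a ⟶ b => α.toPath) := by
    intro p hp
    cases p with
    | nil => exact Or.inl ⟨rfl, rfl⟩
    | cons p α =>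
      cases p with
      | nil => exact Or.inr ⟨α, rfl⟩
      | cons p β => simp at hp
  refine Set.Finite.subset (Set.Finite.union (Set.Subsingleton.finite ?_) (Set.finite_range _)) h
  rintro p ⟨h, rfl⟩ q ⟨h', rfl⟩
  rfl

variable (K : Type u) [Field K] (V : Type v) [Quiver.{w} V] [Fintype V]

/-- The class of a path in `KQ / J²`. -/
noncomputable def ofPath {a b : V} (p : Quiver.Path a b) : RadSqZero K V :=
  Ideal.Quotient.mk _ (PathAlgebra.ofPath p)

/-- The ideal `J / J²` of `KQ / J²`. -/
noncomputable def arrowIdeal : TwoSidedIdeal (RadSqZero K V) :=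
  TwoSidedIdeal.span {x | ∃ (a b : V) (α : a ⟶ b), x = ofPath K V α.toPath}

theorem pathAlgebra_ofPath_mul {a b c : V} (p : Quiver.Path a b) (q : Quiver.Path b c) :
    (PathAlgebra.ofPath p * PathAlgebra.ofPath q : PathAlgebra K V) =
      PathAlgebra.ofPath (p.comp q) := by
  classical
  funext x y
  rw [PathAlgebra.mul_apply]
  simp only [PathAlgebra.ofPath, PathAlgebra.incl_apply]
  by_cases hx : x = a
  · subst hx
    by_cases hy : y = c
    · subst hy
      rw [Finset.sum_eq_single b]
      · simp [pathMul_single]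
      · intro z _ hz
        simp [Pi.single_eq_of_ne hz]
      · simp
    · refine (Finset.sum_eq_zero fun z _ => ?_).trans ?_
      · by_cases hz : z = b
        · subst hz
          simp [Pi.single_eq_of_ne hy]
        · simp [Pi.single_eq_of_ne hz]
      · simp [Pi.single_eq_of_ne hy]
  · simp [Pi.single_eq_of_ne hx]

theorem ofPath_eq_zero {a b : V} (p : Quiver.Path a b) (hp : 2 ≤ p.length) :
    ofPath K V p = 0 := by
  have harr : ∀ {x y : V} (α : x ⟶ y), (PathAlgebra.ofPath α.toPath : PathAlgebra K V) ∈
      (PathAlgebra.arrowIdeal K V).asIdeal := fun α =>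
    TwoSidedIdeal.mem_asIdeal.2 (TwoSidedIdeal.subset_span ⟨_, _, α, rfl⟩)
  cases p with
  | nil => simp at hp
  | cons p β =>
    cases p with
    | nil => simp at hp
    | cons p α =>
      rw [ofPath, Ideal.Quotient.eq_zero_iff_mem]
      have h : (PathAlgebra.ofPath ((p.cons α).cons β) : PathAlgebra K V) =
          (PathAlgebra.ofPath p * PathAlgebra.ofPath α.toPath) * PathAlgebra.ofPath β.toPath := by
        rw [pathAlgebra_ofPath_mul, pathAlgebra_ofPath_mul]
        rfl
      rw [h]
      exact Ideal.mul_mem_mul (Ideal.mul_mem_left _ _ (harr α)) (harr β)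

instance moduleFinite [∀ a b : V, Finite (a ⟶ b)] : Module.Finite K (RadSqZero K V) := by
  classical
  refine ⟨⟨(Set.Finite.toFinset (s := ⋃ a : V, ⋃ b : V,
    (fun p : Quiver.Path a b => ofPath K V p) '' {p | p.length < 2})
    (Set.finite_iUnion fun a => Set.finite_iUnion fun b => (finite_paths V a b).image _)), ?_⟩⟩
  rw [Set.Finite.coe_toFinset, eq_top_iff]
  rintro x -
  obtain ⟨f, rfl⟩ := Ideal.Quotient.mk_surjective x
  set S := Submodule.span K (⋃ a : V, ⋃ b : V,
    (fun p : Quiver.Path a b => ofPath K V p) '' {p | p.length < 2})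
  have key : ∀ (a b : V) (g : Quiver.Path a b →₀ K),
      Ideal.Quotient.mkₐ K ((PathAlgebra.arrowIdeal K V).asIdeal *
        (PathAlgebra.arrowIdeal K V).asIdeal) (PathAlgebra.incl a b g) ∈ S := by
    intro a b g
    induction g using Finsupp.induction_linear with
    | zero => rw [map_zero, map_zero]; exact S.zero_mem
    | add g g' hg hg' => rw [map_add, map_add]; exact S.add_mem hg hg'
    | single p r =>
      have h1 : Finsupp.single p r = r • Finsupp.single p (1 : K) := by simp
      rw [h1, map_smul, map_smul]
      refine S.smul_mem _ ?_
      change ofPath K V p ∈ S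
      by_cases hp : p.length < 2
      · exact Submodule.subset_span (Set.mem_iUnion.2 ⟨a, Set.mem_iUnion.2 ⟨b, p, hp, rfl⟩⟩)
      · rw [ofPath_eq_zero K V p (not_lt.1 hp)]; exact S.zero_mem
  have hf : f = ∑ a, ∑ b, PathAlgebra.incl a b (f a b) := by
    have e1 : ∀ a, (∑ b, PathAlgebra.incl a b (f a b)) =
        (LinearMap.single K (fun a : V => ∀ b : V, Quiver.Path a b →₀ K) a (f a) :
          PathAlgebra K V) := by
      intro a
      have e2 : ∑ b, LinearMap.single K (fun b : V => Quiver.Path a b →₀ K) b (f a b) = f a :=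
        Finset.univ_sum_single (f a)
      conv_rhs => rw [← e2]
      exact (map_sum (LinearMap.single K (fun a : V => ∀ b : V, Quiver.Path a b →₀ K) a)
        _ Finset.univ).symm
    simp_rw [e1]
    exact (Finset.univ_sum_single (M := fun a : V => ∀ b : V, Quiver.Path a b →₀ K) f).symm
  change Ideal.Quotient.mkₐ K ((PathAlgebra.arrowIdeal K V).asIdeal *
        (PathAlgebra.arrowIdeal K V).asIdeal) f ∈ S
  rw [hf, map_sum]
  refine S.sum_mem fun a _ => ?_
  rw [map_sum]
  exact S.sum_mem fun b _ => key a b _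

instance isArtinianRing_op [∀ a b : V, Finite (a ⟶ b)] : IsArtinianRing (RadSqZero K V)ᵐᵒᵖ :=
  IsArtinianRing.of_finite K _

end RadSqZero

end PathAlgebra

section IgusaTodorov

variable {R : Type u} [Ring R]

/-- `π` is a projective cover: `P` is projective, `π` is onto and its kernel is superfluous. -/
structure IsProjectiveCover {P M : Type u} [AddCommGroup P] [Module R P] [AddCommGroup M]
    [Module R M] (π : P →ₗ[R] M) : Prop where
  projective : Module.Projective R P
  surjective : Function.Surjective π
  superfluous : ∀ N : Submodule R P, N ⊔ LinearMap.ker π = ⊤ → N = ⊤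

/-- `ι` is an injective envelope: `I` is injective, `ι` is one-to-one and its image is
essential. -/
structure IsInjectiveEnvelope {M I : Type u} [AddCommGroup M] [Module R M] [AddCommGroup I]
    [Module R I] (ι : M →ₗ[R] I) : Prop where
  injective_module : Module.Injective R I
  injective : Function.Injective ι
  essential : ∀ N : Submodule R I, N ⊓ LinearMap.range ι = ⊥ → N = ⊥

/-- `N` is (isomorphic to) the first syzygy of `M`. -/
def IsSyzygy (M N : FGModuleCat.{u} R) : Prop :=
  ∃ (P : FGModuleCat.{u} R) (π : P →ₗ[R] M),
    IsProjectiveCover π ∧ Nonempty (N ≃ₗ[R] LinearMap.ker π)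

/-- `N` is (isomorphic to) the first cosyzygy of `M`. -/
def IsCosyzygy (M N : FGModuleCat.{u} R) : Prop :=
  ∃ (I : FGModuleCat.{u} R) (ι : M →ₗ[R] I),
    IsInjectiveEnvelope ι ∧ Nonempty (N ≃ₗ[R] (I ⧸ LinearMap.range ι))

/-- The `n`-fold composition of a relation with itself. -/
def iterRel {α : Type v} (r : α → α → Prop) : ℕ → α → α → Prop
  | 0 => Eq
  | n + 1 => Relation.Comp (iterRel r n) r

variable (R) in
/-- The defining relations of `K₀`. -/
def stableRelations : Set (FreeAbelianGroup (FGModuleCat.{u} R)) :=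
  {z | ∃ M M' M'' : FGModuleCat.{u} R, Nonempty (M ≃ₗ[R] M' × M'') ∧
      z = FreeAbelianGroup.of M - FreeAbelianGroup.of M' - FreeAbelianGroup.of M''} ∪
  {z | ∃ P : FGModuleCat.{u} R, Module.Projective R P ∧ z = FreeAbelianGroup.of P}

variable (R) in
/-- The group `K₀` generated by the symbols `[M]` of the finitely generated modules, with relations
`[M] = [M'] + [M'']` if `M ≅ M' ⊕ M''`, and `[P] = 0` if `P` is projective. In particular
isomorphic modules have the same symbol, because `M ≅ N` gives `M ≅ N ⊕ 0`. -/
abbrev StableK₀ : Type (u + 1) :=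
  FreeAbelianGroup (FGModuleCat.{u} R) ⧸ AddSubgroup.closure (stableRelations R)

namespace StableK₀

/-- The class `[M]` of a module in `K₀`. -/
def cls (M : FGModuleCat.{u} R) : StableK₀ R :=
  QuotientAddGroup.mk (FreeAbelianGroup.of M)

theorem cls_prod {M M' M'' : FGModuleCat.{u} R} (e : M ≃ₗ[R] M' × M'') :
    cls M = cls M' + cls M'' := by
  have h : (QuotientAddGroup.mk (FreeAbelianGroup.of M - FreeAbelianGroup.of M' -
      FreeAbelianGroup.of M'') : StableK₀ R) = 0 :=
    (QuotientAddGroup.eq_zero_iff _).2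
      (AddSubgroup.subset_closure (Or.inl ⟨M, M', M'', ⟨e⟩, rfl⟩))
  have h' : cls M - cls M' - cls M'' = 0 := h
  rw [sub_sub, sub_eq_zero] at h'
  exact h'

theorem cls_projective (P : FGModuleCat.{u} R) (hP : Module.Projective R P) : cls P = 0 :=
  (QuotientAddGroup.eq_zero_iff _).2 (AddSubgroup.subset_closure (Or.inr ⟨P, hP, rfl⟩))

theorem cls_congr {M N : FGModuleCat.{u} R} (e : M ≃ₗ[R] N) : cls M = cls N := by
  have h := cls_prod (M := M) (M' := N) (M'' := FGModuleCat.of R PUnit.{u + 1})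
    (e.trans (LinearEquiv.prodUnique (R := R) (M := N) (M₂ := PUnit.{u + 1})).symm)
  rw [h, cls_projective (FGModuleCat.of R PUnit.{u + 1})
    (inferInstanceAs (Module.Projective R PUnit.{u + 1})), add_zero]

end StableK₀

theorem equiv_ker_prod {X P : Type u} [AddCommGroup X] [Module R X] [AddCommGroup P] [Module R P]
    [Module.Projective R P] (f : X →ₗ[R] P) (hf : Function.Surjective f) :
    Nonempty (X ≃ₗ[R] LinearMap.ker f × P) := by
  obtain ⟨s, hs⟩ := Module.projective_lifting_property f LinearMap.id hf
  have hc := LinearMap.isCompl_of_proj (p := LinearMap.range s)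
    (f := s.rangeRestrict ∘ₗ f) (by
      rintro ⟨x, y, rfl⟩
      ext
      have := LinearMap.congr_fun hs y
      simp only [LinearMap.comp_apply, LinearMap.id_apply] at this
      simp [this])
  have hinj : Function.Injective s := fun x y h => by
    have h1 := LinearMap.congr_fun hs x
    have h2 := LinearMap.congr_fun hs y
    simp only [LinearMap.comp_apply, LinearMap.id_apply] at h1 h2
    rw [← h1, ← h2, h]
  have hk : LinearMap.ker (s.rangeRestrict ∘ₗ f) = LinearMap.ker f := by
    ext x
    simp only [LinearMap.mem_ker, LinearMap.comp_apply]
    constructor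
    · intro h
      have : s (f x) = 0 := congrArg Subtype.val h
      exact hinj (by rw [this, map_zero])
    · intro h
      rw [h, map_zero]
  rw [hk] at hc
  exact ⟨(Submodule.prodEquivOfIsCompl _ _ hc.symm).symm.trans
    (LinearEquiv.prodCongr (LinearEquiv.refl R _) (LinearEquiv.ofInjective s hinj).symm)⟩

variable [IsArtinianRing R]

/-- The kernel of a linear map between finitely generated modules over an artinian ring. -/
abbrev kerFG {M N : FGModuleCat.{u} R} (f : M →ₗ[R] N) : FGModuleCat.{u} R :=
  FGModuleCat.of R (LinearMap.ker f)

theorem exists_isProjectiveCover (M : FGModuleCat.{u} R) :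
    ∃ (P : FGModuleCat.{u} R) (π : P →ₗ[R] M), IsProjectiveCover π := by
  obtain ⟨n, f, hf⟩ := Module.Finite.exists_fin' R M
  let C : Set (Submodule R (Fin n → R)) :=
    {N | Module.Projective R N ∧ Function.Surjective (f ∘ₗ N.subtype)}
  have hC : C.Nonempty := by
    refine ⟨⊤, ?_, ?_⟩
    · exact Module.Projective.of_equiv (Submodule.topEquiv (R := R) (M := Fin n → R)).symm
    · intro x
      obtain ⟨y, rfl⟩ := hf x
      exact ⟨⟨y, trivial⟩, rfl⟩
  obtain ⟨N, ⟨hN, hs⟩, hmin⟩ := wellFounded_lt.has_min C hC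
  refine ⟨FGModuleCat.of R N, f ∘ₗ N.subtype, hN, hs, ?_⟩
  intro L hL
  have hL : (L : Submodule R N) ⊔ LinearMap.ker (f ∘ₗ N.subtype) = ⊤ := hL
  set π : N →ₗ[R] M := f ∘ₗ N.subtype with hπ
  have hLs : Function.Surjective (π ∘ₗ L.subtype) := by
    intro x
    obtain ⟨y, rfl⟩ := hs x
    have hy : y ∈ L ⊔ LinearMap.ker π := by rw [hL]; trivial
    obtain ⟨a, ha, b, hb, rfl⟩ := Submodule.mem_sup.1 hy
    refine ⟨⟨a, ha⟩, ?_⟩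
    rw [map_add, LinearMap.mem_ker.1 hb, add_zero]
    rfl
  obtain ⟨h, hh⟩ := Module.projective_lifting_property (π ∘ₗ L.subtype) π hLs
  let g : Module.End R N := L.subtype ∘ₗ h
  have hg : ∀ x, π (g x) = π x := fun x => LinearMap.congr_fun hh x
  have hgk : ∀ (k : ℕ) (x : N), π ((g ^ k) x) = π x := by
    intro k
    induction k with
    | zero => intro x; rfl
    | succ k ih => intro x; rw [pow_succ', Module.End.mul_apply, hg, ih]
  obtain ⟨k, hk⟩ := Filter.eventually_atTop.1 (LinearMap.eventually_isCompl_ker_pow_range_pow g)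
  have hk1 := hk (k + 1) (Nat.le_succ k)
  have hproj : Module.Projective R (LinearMap.range (g ^ (k + 1))) := by
    refine Module.Projective.of_split (LinearMap.range (g ^ (k + 1))).subtype
      (Submodule.projectionOnto _ _ hk1.symm) ?_
    refine LinearMap.ext fun x => ?_
    exact Submodule.projectionOnto_apply_left hk1.symm x
  let N' : Submodule R (Fin n → R) := (LinearMap.range (g ^ (k + 1))).map N.subtype
  have hN'C : N' ∈ C := by
    refine ⟨?_, ?_⟩
    · exact Module.Projective.of_equiv
        (Submodule.equivMapOfInjective N.subtype N.injective_subtype _)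
    · intro x
      obtain ⟨y, rfl⟩ := hs x
      refine ⟨⟨((g ^ (k + 1)) y : N), ⟨_, ⟨y, rfl⟩, rfl⟩⟩, ?_⟩
      exact hgk (k + 1) y
  have hle : N' ≤ N := by
    rintro _ ⟨x, -, rfl⟩
    exact x.2
  have heq : N' = N := by
    by_contra hne
    exact hmin N' hN'C (lt_of_le_of_ne hle hne)
  rw [eq_top_iff]
  rintro x -
  have hx : (x : Fin n → R) ∈ N' := by rw [heq]; exact x.2
  obtain ⟨y, ⟨z, rfl⟩, hy⟩ := hx
  have : (g ^ (k + 1)) z = x := Subtype.ext hy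
  rw [← this, pow_succ', Module.End.mul_apply]
  exact (h _).2

theorem exists_isSyzygy (M : FGModuleCat.{u} R) : ∃ N, IsSyzygy M N := by
  obtain ⟨P, π, h⟩ := exists_isProjectiveCover M
  exact ⟨kerFG π, P, π, h, ⟨LinearEquiv.refl R _⟩⟩

/-- The first syzygy `Ω M`, the kernel of a projective cover of `M`. -/
noncomputable def syzygy (M : FGModuleCat.{u} R) : FGModuleCat.{u} R :=
  (exists_isSyzygy M).choose

theorem isSyzygy_syzygy (M : FGModuleCat.{u} R) : IsSyzygy M (syzygy M) :=
  (exists_isSyzygy M).choose_spec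

theorem cls_ker_eq {M P P' : FGModuleCat.{u} R} (hP : Module.Projective R P)
    (hP' : Module.Projective R P') (π : P →ₗ[R] M) (π' : P' →ₗ[R] M)
    (hπ : Function.Surjective π) (hπ' : Function.Surjective π') :
    StableK₀.cls (kerFG π) = StableK₀.cls (kerFG π') := by
  have main : ∀ {P P' : FGModuleCat.{u} R} (_ : Module.Projective R P) (π : P →ₗ[R] M)
      (π' : P' →ₗ[R] M) (_ : Function.Surjective π'),
      StableK₀.cls (FGModuleCat.of R (LinearMap.ker (π.coprod π'))) =
        StableK₀.cls (kerFG π') := by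
    intro P P' hP π π' hπ'
    let f : LinearMap.ker (π.coprod π') →ₗ[R] P :=
      LinearMap.fst R P P' ∘ₗ (LinearMap.ker (π.coprod π')).subtype
    have hf : Function.Surjective f := by
      intro x
      obtain ⟨y, hy⟩ := hπ' (-(π x))
      exact ⟨⟨(x, y), by simp [hy]⟩, rfl⟩
    let e : LinearMap.ker f ≃ₗ[R] LinearMap.ker π' :=
      { toFun := fun z => ⟨z.1.1.2, by
          have h1 : z.1.1.1 = 0 := z.2
          have h2 : π z.1.1.1 + π' z.1.1.2 = 0 := z.1.2
          rw [h1, map_zero, zero_add] at h2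
          exact h2⟩
        map_add' := fun _ _ => rfl
        map_smul' := fun _ _ => rfl
        invFun := fun y => ⟨⟨(0, y.1), by simp⟩, rfl⟩
        left_inv := fun z => by
          have h1 : z.1.1.1 = 0 := z.2
          ext
          · exact h1.symm
          · rfl
        right_inv := fun y => rfl }
    obtain ⟨s⟩ := equiv_ker_prod f hf
    have h := StableK₀.cls_prod (M := FGModuleCat.of R (LinearMap.ker (π.coprod π')))
      (M' := kerFG π') (M'' := P)
      (s.trans (LinearEquiv.prodCongr e (LinearEquiv.refl R P)))
    rw [h, StableK₀.cls_projective P hP, add_zero]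
  have h1 := main hP π π' hπ'
  have h2 := main hP' π' π hπ
  let e : LinearMap.ker (π.coprod π') ≃ₗ[R] LinearMap.ker (π'.coprod π) :=
    (LinearEquiv.prodComm R P P').ofSubmodules _ _ (by
      ext ⟨x, y⟩
      simp [add_comm])
  have h3 := StableK₀.cls_congr (M := FGModuleCat.of R (LinearMap.ker (π.coprod π')))
    (N := FGModuleCat.of R (LinearMap.ker (π'.coprod π))) e
  rw [← h1, ← h2, h3]

/-- Any finitely generated projective presentation computes the class of the syzygy. -/
theorem cls_syzygy {M P : FGModuleCat.{u} R} (hP : Module.Projective R P) (π : P →ₗ[R] M)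
    (hπ : Function.Surjective π) :
    StableK₀.cls (syzygy M) = StableK₀.cls (kerFG π) := by
  obtain ⟨P', π', h, ⟨e⟩⟩ := isSyzygy_syzygy M
  rw [StableK₀.cls_congr (N := kerFG π') e]
  exact cls_ker_eq h.projective hP π' π h.surjective hπ

theorem cls_syzygy_prod {M M' M'' : FGModuleCat.{u} R} (e : M ≃ₗ[R] M' × M'') :
    StableK₀.cls (syzygy M) = StableK₀.cls (syzygy M') + StableK₀.cls (syzygy M'') := by
  obtain ⟨P', π', h', ⟨e'⟩⟩ := isSyzygy_syzygy M'
  obtain ⟨P'', π'', h'', ⟨e''⟩⟩ := isSyzygy_syzygy M''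
  have hp' := h'.projective
  have hp'' := h''.projective
  let P : FGModuleCat.{u} R := FGModuleCat.of R (P' × P'')
  let π : P →ₗ[R] M := e.symm.toLinearMap ∘ₗ (π'.prodMap π'')
  have hπ : Function.Surjective π :=
    e.symm.surjective.comp (Function.Surjective.prodMap h'.surjective h''.surjective)
  have hP : Module.Projective R P := inferInstanceAs (Module.Projective R (P' × P''))
  rw [cls_syzygy hP π hπ, StableK₀.cls_congr (N := kerFG π') e',
    StableK₀.cls_congr (N := kerFG π'') e'']
  have hk : ∀ z : P' × P'', z ∈ LinearMap.ker π ↔ π' z.1 = 0 ∧ π'' z.2 = 0 := by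
    intro z
    have : π z = e.symm (π' z.1, π'' z.2) := rfl
    rw [LinearMap.mem_ker, this, LinearEquiv.map_eq_zero_iff, Prod.mk_eq_zero]
  refine StableK₀.cls_prod
    { toFun := fun z => (⟨z.1.1, ((hk z.1).1 z.2).1⟩, ⟨z.1.2, ((hk z.1).1 z.2).2⟩)
      map_add' := fun _ _ => rfl
      map_smul' := fun _ _ => rfl
      invFun := fun z => ⟨(z.1.1, z.2.1), (hk _).2 ⟨z.1.2, z.2.2⟩⟩
      left_inv := fun _ => rfl
      right_inv := fun _ => rfl }

theorem cls_syzygy_projective (P : FGModuleCat.{u} R) (hP : Module.Projective R P) :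
    StableK₀.cls (syzygy P) = 0 := by
  rw [cls_syzygy hP LinearMap.id Function.surjective_id]
  refine StableK₀.cls_projective _ ?_
  have : Subsingleton (LinearMap.ker (LinearMap.id : P →ₗ[R] P)) := by
    rw [LinearMap.ker_id]; infer_instance
  exact inferInstanceAs (Module.Projective R (LinearMap.ker (LinearMap.id : P →ₗ[R] P)))

variable (R) in
/-- The endomorphism of `K₀` induced by `Ω`, sending `[M]` to `[Ω M]`. -/
noncomputable def omegaBar : StableK₀ R →+ StableK₀ R :=
  QuotientAddGroup.lift (AddSubgroup.closure (stableRelations R))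
    (FreeAbelianGroup.lift fun M => StableK₀.cls (syzygy M)) (by
      rw [AddSubgroup.closure_le]
      rintro z (⟨M, M', M'', ⟨e⟩, rfl⟩ | ⟨P, hP, rfl⟩)
      · simp [cls_syzygy_prod e]
      · simp [cls_syzygy_projective P hP])

theorem omegaBar_cls (M : FGModuleCat.{u} R) :
    omegaBar R (StableK₀.cls M) = StableK₀.cls (syzygy M) := by
  simp [omegaBar, StableK₀.cls]

end IgusaTodorov

section Phi

variable {R : Type u} [Ring R]

/-- A nonzero module which is not a direct sum of two nonzero modules. -/
def IsIndecomposableModule (M : FGModuleCat.{u} R) : Prop :=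
  Nontrivial M ∧ ∀ X Y : FGModuleCat.{u} R, Nonempty (M ≃ₗ[R] X × Y) →
    Subsingleton X ∨ Subsingleton Y

/-- The subgroup `⟨add M⟩` of `K₀` generated by the classes of the indecomposable direct summands
of `M`. -/
def addSpan (M : FGModuleCat.{u} R) : AddSubgroup (StableK₀ R) :=
  AddSubgroup.closure {z | ∃ N N' : FGModuleCat.{u} R,
    IsIndecomposableModule N ∧ Nonempty (M ≃ₗ[R] N × N') ∧ z = StableK₀.cls N}

/-- The Igusa-Todorov function: the least `l` such that the induced endomorphism of `K₀` is
injective on its `(l + s)`-th image of `⟨add M⟩` for all `s` (and `⊤` if there were no such `l`). -/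
noncomputable def igusaTodorovPhi [IsArtinianRing R] (M : FGModuleCat.{u} R) : ℕ∞ :=
  ⨅ (l : ℕ) (_ : ∀ s : ℕ, Set.InjOn (omegaBar R)
    ((omegaBar R)^[l + s] '' (addSpan M : Set (StableK₀ R)))), (l : ℕ∞)

/-- The `φ`-dimension: the supremum of `φ` over the finitely generated left `R`-modules. -/
noncomputable def phiDim (R : Type u) [Ring R] [IsArtinianRing R] : ℕ∞ :=
  ⨆ M : FGModuleCat.{u} R, igusaTodorovPhi M

end Phi

section Hearts

variable (K : Type u) [Field K] (V : Type v) [Quiver.{w} V] [Fintype V]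

/-- The right module `A₀ = KQ / J = A / (J / J²)` over `A = KQ / J²`. Right `A`-modules are
modules over the opposite ring. -/
noncomputable def semisimpleTop : FGModuleCat.{max u v w} (RadSqZero K V)ᵐᵒᵖ :=
  FGModuleCat.of _
    ((RadSqZero K V)ᵐᵒᵖ ⧸ TwoSidedIdeal.asIdealOpposite (RadSqZero.arrowIdeal K V))

variable {K V} in
/-- The support of a right module `N`: the vertices `v` whose simple module is a composition factor
of `N`, i.e. such that `N e_v ≠ 0`, where `e_v` is the trivial path at `v`. -/
def moduleSupport (N : FGModuleCat.{max u v w} (RadSqZero K V)ᵐᵒᵖ) : Set V :=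
  {v | ∃ x : N, MulOpposite.op (RadSqZero.ofPath K V (Quiver.Path.nil : Quiver.Path v v)) • x ≠ 0}

/-- The vertices of the heart of the quiver: with `n` the number of vertices, the intersection of
the supports of the `n`-th syzygy and of the `n`-th cosyzygy of `A₀`. -/
def heart : Set V :=
  {v | (∃ N, iterRel IsSyzygy (Fintype.card V) (semisimpleTop K V) N ∧ v ∈ moduleSupport N) ∧
    ∃ N, iterRel IsCosyzygy (Fintype.card V) (semisimpleTop K V) N ∧ v ∈ moduleSupport N}

/-- The vertices of the member of the quiver: those which are not in the heart. -/
def member : Set V := (heart K V)ᶜ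

end Hearts

section Subhearts

variable {V : Type v} [Quiver.{w} V]

/-- A final subheart: a minimal nonempty full subquiver closed under successors. A full subquiver
is given by its set of vertices. -/
def IsFinalSubheart (S : Set V) : Prop :=
  Minimal (fun T : Set V => T.Nonempty ∧ ∀ a b : V, Nonempty (a ⟶ b) → a ∈ T → b ∈ T) S

/-- An initial subheart: a minimal nonempty full subquiver closed under predecessors. -/
def IsInitialSubheart (S : Set V) : Prop :=
  Minimal (fun T : Set V => T.Nonempty ∧ ∀ a b : V, Nonempty (a ⟶ b) → b ∈ T → a ∈ T) S

end Subhearts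

/-! ### Kernels of powers of a nonnegative block triangular matrix. -/

section NonnegativeMatrices

/-! Both statements follow from one: if the quiver is not strongly connected, its `φ`-dimension is
smaller than the number `n` of vertices. For the second statement, a nonempty proper set of vertices
closed under successors or under predecessors rules out strong connectivity.

Because the radical has square zero, `Ω M` lies in the radical of a projective cover of `M` and is
therefore semisimple, without simple summands at sources (`exists_omegaBar_cls`). On classes of
simples, `Ω` acts by a matrix `a` of nonnegative integers whose nonzero entries occur only along
arrows. The class of the simple at a sink is zero; the other classes of simples are independent in
`K₀`, since additive multiplicities that vanish on projectives separate them
(`combination_eq_zero_iff`). So one application of `Ω` reduces everything to row vectors `z`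
vanishing at the sources, read only off the sinks, under `z ↦ z a`.

The core is `vecMul_pow_eq_zero_of_succ`: if `n ≤ k + 2` and `z a ^ (k + 1)` vanishes off the sinks,
so does `z a ^ k`. Let `b` be the restriction of `a` to the set `U` of vertices that are neither
sinks nor sources. A kernel still growing at step `k` forces `rank (b ^ (k + 1)) + k + 1 ≤ |U|`. If
`U` is everything, a set closed under successors makes `a` block triangular without zero rows or
columns, so the rank is at least two, which is too much. If one vertex is missing, the rank is zero;
but removing a lone source leaves no zero row in `b`, and removing a lone sink no zero column, so
`b` is not nilpotent. If two are missing, even rank zero does not fit. Counting the first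
application of `Ω`, the kernels are stable from `l = n - 1` on. -/

theorem Module.End.finrank_range_pow_add_le {F E : Type*} [Field F] [AddCommGroup E] [Module F E]
    [FiniteDimensional F E] (f : Module.End F E) {k : ℕ}
    (h : LinearMap.ker (f ^ k) ≠ LinearMap.ker (f ^ (k + 1))) :
    Module.finrank F (LinearMap.range (f ^ (k + 1))) + (k + 1) ≤ Module.finrank F E := by
  have mono : ∀ j, LinearMap.ker (f ^ j) ≤ LinearMap.ker (f ^ (j + 1)) := fun j x hx => by
    rw [LinearMap.mem_ker] at hx ⊢
    rw [pow_succ', Module.End.mul_apply, hx, map_zero]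
  -- Once two consecutive kernels agree the chain is constant, so growth at step `k` means growth at
  -- every earlier step, by at least one dimension each time.
  have strict : ∀ j ≤ k, LinearMap.ker (f ^ j) < LinearMap.ker (f ^ (j + 1)) := by
    intro j hj
    refine lt_of_le_of_ne (mono j) fun hj' => h ?_
    have h1 := Module.End.ker_pow_constant hj' (k - j)
    have h2 := Module.End.ker_pow_constant hj' (k - j + 1)
    rw [Nat.add_sub_cancel' hj] at h1
    rw [← add_assoc, Nat.add_sub_cancel' hj] at h2
    rw [← h1, h2]
  have dim : ∀ j ≤ k + 1, j ≤ Module.finrank F (LinearMap.ker (f ^ j)) := by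
    intro j
    induction j with
    | zero => simp
    | succ j ih =>
      intro hj
      have := Submodule.finrank_lt_finrank_of_lt (strict j (by omega))
      have := ih (by omega)
      omega
  have := dim (k + 1) le_rfl
  have := LinearMap.finrank_range_add_finrank_ker (f ^ (k + 1))
  omega

namespace Matrix

variable {U : Type*} [Fintype U] [DecidableEq U]

theorem pow_nonneg_of_nonneg {b : Matrix U U ℚ} (hb : ∀ u v, 0 ≤ b u v) (l : ℕ) (u v : U) :
    0 ≤ (b ^ l) u v := by
  induction l generalizing u v with
  | zero =>
    rw [pow_zero, one_apply]
    split_ifs <;> simp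
  | succ l ih =>
    rw [pow_succ, mul_apply]
    exact Finset.sum_nonneg fun x _ => mul_nonneg (ih u x) (hb x v)

theorem exists_pow_pos_right {b : Matrix U U ℚ} (hb : ∀ u v, 0 ≤ b u v)
    (h : ∀ u, ∃ v, 0 < b u v) (l : ℕ) (u : U) : ∃ v, 0 < (b ^ l) u v := by
  induction l with
  | zero => exact ⟨u, by simp⟩
  | succ l ih =>
    obtain ⟨x, hx⟩ := ih
    obtain ⟨v, hv⟩ := h x
    refine ⟨v, ?_⟩
    rw [pow_succ, mul_apply]
    exact Finset.sum_pos' (fun y _ => mul_nonneg (pow_nonneg_of_nonneg hb l u y) (hb y v))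
      ⟨x, Finset.mem_univ x, mul_pos hx hv⟩

theorem exists_pow_pos_left {b : Matrix U U ℚ} (hb : ∀ u v, 0 ≤ b u v)
    (h : ∀ v, ∃ u, 0 < b u v) (l : ℕ) (v : U) : ∃ u, 0 < (b ^ l) u v := by
  obtain ⟨u, hu⟩ := exists_pow_pos_right (b := bᵀ) (fun u v => hb v u) h l v
  rw [← transpose_pow] at hu
  exact ⟨u, hu⟩

/-- A nonzero entry of a power comes from a walk along nonzero entries, and such a walk cannot leave
a closed set. -/
theorem mem_of_pow_ne_zero {b : Matrix U U ℚ} {S : Set U}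
    (hS : ∀ u v, b u v ≠ 0 → u ∈ S → v ∈ S) (l : ℕ) {u v : U} (h : (b ^ l) u v ≠ 0)
    (hu : u ∈ S) : v ∈ S := by
  induction l generalizing v with
  | zero =>
    rw [pow_zero, one_apply] at h
    have : u = v := by
      by_contra hne
      exact h (if_neg hne)
    exact this ▸ hu
  | succ l ih =>
    rw [pow_succ, mul_apply] at h
    obtain ⟨x, -, hx⟩ := Finset.exists_ne_zero_of_sum_ne_zero h
    exact hS x v (right_ne_zero_of_mul hx) (ih (left_ne_zero_of_mul hx))

theorem toLin'_transpose_pow (b : Matrix U U ℚ) (l : ℕ) (z : U → ℚ) :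
    (toLin' bᵀ ^ l) z = z ᵥ* b ^ l := by
  rw [← toLin'_pow, toLin'_apply, ← transpose_pow, mulVec_transpose]

/-- If a set of indices and its complement are nonempty, and the matrix has no nonzero entry
leading out of that set, then a power without zero rows and zero columns has rank at least two. -/
theorem two_le_finrank_range {c : Matrix U U ℚ} {S : Set U} {u w : U} (hu : u ∈ S) (hw : w ∉ S)
    (hS : ∀ u v, c u v ≠ 0 → u ∈ S → v ∈ S) (hrow : ∀ u, ∃ v, 0 < c u v)
    (hcol : ∀ v, ∃ u, 0 < c u v) : 2 ≤ Module.finrank ℚ (LinearMap.range (toLin' cᵀ)) := by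
  obtain ⟨v, hv⟩ := hrow u
  obtain ⟨x, hx⟩ := hcol w
  -- Row `u` vanishes at `w`, while row `x` does not: coordinate `w` kills the coefficient of row
  -- `x`, then coordinate `v` that of row `u`.
  have huw : c u w = 0 := by
    by_contra h
    exact hw (hS u w h hu)
  have hlin : LinearIndependent ℚ ![c u, c x] := by
    rw [LinearIndependent.pair_iff]
    intro s t hst
    have ht : t = 0 := by
      have := congrFun hst w
      simp only [Pi.add_apply, Pi.smul_apply, huw, smul_eq_mul, mul_zero, zero_add,
        Pi.zero_apply, mul_eq_zero] at this
      exact this.resolve_right hx.ne'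
    subst ht
    have := congrFun hst v
    simp only [Pi.add_apply, Pi.smul_apply, smul_eq_mul, zero_mul, add_zero,
      Pi.zero_apply, mul_eq_zero] at this
    exact ⟨this.resolve_right hv.ne', rfl⟩
  have hspan : Submodule.span ℚ (Set.range ![c u, c x]) ≤ LinearMap.range (toLin' cᵀ) := by
    rw [Submodule.span_le]
    rintro _ ⟨i, rfl⟩
    have key : ∀ y, c y ∈ LinearMap.range (toLin' cᵀ) := fun y =>
      ⟨Pi.single y 1, by rw [toLin'_apply, mulVec_transpose, single_one_vecMul]; rfl⟩
    fin_cases i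
    · exact key u
    · exact key x
  have := Submodule.finrank_mono hspan
  rwa [finrank_span_eq_card hlin, Fintype.card_fin] at this

/-- For a nonnegative matrix with a block triangular decomposition, a vector in the span of the
nonzero columns that vanishes modulo the zero rows after `k + 1` steps does so after `k` steps,
provided that `k + 2` is at least the size of the matrix. -/
theorem vecMul_pow_eq_zero_of_succ {V : Type*} [Fintype V] [DecidableEq V] {a : Matrix V V ℚ}
    (ha : ∀ u v, 0 ≤ a u v) {S : Set V} {p q : V} (hp : p ∈ S) (hq : q ∉ S)
    (hS : ∀ u v, a u v ≠ 0 → u ∈ S → v ∈ S) {k : ℕ} (hk : Fintype.card V ≤ k + 2) {z : V → ℚ}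
    (hz : ∀ w, (∀ v, a v w = 0) → z w = 0)
    (h : ∀ v, (∃ w, a v w ≠ 0) → (z ᵥ* a ^ (k + 1)) v = 0) {v : V} (hv : ∃ w, a v w ≠ 0) :
    (z ᵥ* a ^ k) v = 0 := by
  classical
  -- The vertices that are neither sinks nor sources. Sources always carry the value zero, and sinks
  -- pass nothing on, so the dynamics off the sinks is that of `b`.
  let U := {u : V // (∃ w, a u w ≠ 0) ∧ ∃ w, a w u ≠ 0}
  let b : Matrix U U ℚ := fun u v => a u v
  have hsrc : ∀ (l : ℕ) (w : V), (∀ v, a v w = 0) → (z ᵥ* a ^ l) w = 0 := by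
    intro l w hw
    cases l with
    | zero => simpa using hz w hw
    | succ l =>
      rw [pow_succ, ← vecMul_vecMul]
      simp [vecMul, dotProduct, hw]
  have hres : ∀ (l : ℕ) (u : U), (z ᵥ* a ^ l) u = ((fun u : U => z u) ᵥ* b ^ l) u := by
    intro l
    induction l with
    | zero => intro u; simp
    | succ l ih =>
      intro u
      rw [pow_succ, ← vecMul_vecMul, pow_succ, ← vecMul_vecMul]
      rw [vecMul, vecMul, dotProduct, dotProduct]
      rw [← Finset.sum_subset (Finset.subset_univ
        (Finset.univ.filter fun u : V => (∃ w, a u w ≠ 0) ∧ ∃ w, a w u ≠ 0))]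
      · rw [Finset.sum_subtype (p := fun u : V => (∃ w, a u w ≠ 0) ∧ ∃ w, a w u ≠ 0) _ (by simp)]
        exact Finset.sum_congr rfl fun x _ => by rw [ih x]
      · intro x _ hx
        simp only [Finset.mem_filter, Finset.mem_univ, true_and, not_and_or, not_exists,
          not_not] at hx
        rcases hx with hx | hx
        · rw [hx, mul_zero]
        · rw [hsrc l x hx, zero_mul]
  by_cases hvs : ∀ w, a w v = 0
  · exact hsrc k v hvs
  push Not at hvs
  by_contra hne
  have hb : ∀ u v, 0 ≤ b u v := fun u v => ha u v
  -- A nonzero value of `z a ^ k` at `v` exhibits a vector killed by step `k + 1` of `b` but not by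
  -- step `k`. The transpose turns row vectors into arguments of a linear map.
  have hker : LinearMap.ker (toLin' bᵀ ^ k) ≠ LinearMap.ker (toLin' bᵀ ^ (k + 1)) := by
    intro hker
    have h1 : (fun u : U => z u) ∈ LinearMap.ker (toLin' bᵀ ^ (k + 1)) := by
      rw [LinearMap.mem_ker, toLin'_transpose_pow]
      funext u
      rw [← hres]
      exact h u u.2.1
    rw [← hker, LinearMap.mem_ker, toLin'_transpose_pow] at h1
    apply hne
    have := hres k ⟨v, hv, hvs⟩
    rw [h1] at this
    exact this
  have hrank := Module.End.finrank_range_pow_add_le _ hker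
  rw [Module.finrank_fintype_fun_eq_card] at hrank
  have hU : Fintype.card U ≤ Fintype.card V := Fintype.card_subtype_le _
  have hrange : LinearMap.range (toLin' bᵀ ^ (k + 1)) = LinearMap.range (toLin' (b ^ (k + 1))ᵀ) := by
    rw [← toLin'_pow, transpose_pow]
  rw [hrange] at hrank
  have hsucc : ∀ u : U, ∃ w, 0 < a u w ∧ ∃ x, a x w ≠ 0 := fun u => by
    obtain ⟨w, hw⟩ := u.2.1
    exact ⟨w, lt_of_le_of_ne (ha _ _) hw.symm, u, hw⟩
  have hpred : ∀ u : U, ∃ w, 0 < a w u ∧ ∃ x, a w x ≠ 0 := fun u => by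
    obtain ⟨w, hw⟩ := u.2.2
    exact ⟨w, lt_of_le_of_ne (ha _ _) hw.symm, u, hw⟩
  have hex : (∀ w : V, ∃ x, a w x ≠ 0) → ∀ u : U, ∃ w : U, 0 < b u w := fun hall u => by
    obtain ⟨w, hw, hw'⟩ := hsucc u
    exact ⟨⟨w, hall w, hw'⟩, hw⟩
  have hex' : (∀ w : V, ∃ x, a x w ≠ 0) → ∀ u : U, ∃ w : U, 0 < b w u := fun hall u => by
    obtain ⟨w, hw, hw'⟩ := hpred u
    exact ⟨⟨w, hw', hall w⟩, hw⟩
  -- With no sinks and no sources, `U` is all of `V` and the rank bound gives `2 + (k + 1) ≤ |V| ≤ k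
  -- + 2`.
  by_cases hall : ∀ w : V, (∃ x, a w x ≠ 0) ∧ ∃ x, a x w ≠ 0
  · have h2 := two_le_finrank_range (c := b ^ (k + 1)) (S := {u : U | (u : V) ∈ S})
      (u := ⟨p, hall p⟩) (w := ⟨q, hall q⟩) hp hq
      (fun u v huv hu => mem_of_pow_ne_zero (S := {u : U | (u : V) ∈ S})
        (fun u v => hS u v) _ huv hu)
      (exists_pow_pos_right hb (hex fun w => (hall w).1) _)
      (exists_pow_pos_left hb (hex' fun w => (hall w).2) _)
    omega
  · push Not at hall
    obtain ⟨s, hs⟩ := hall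
    have hlt : Fintype.card U < Fintype.card V := by
      refine Fintype.card_subtype_lt (x := s) ?_
      rintro ⟨h1, x, hx⟩
      exact hx (hs h1 x)
    -- Here `rank + (k + 1) ≤ |U| ≤ |V| - 1 ≤ k + 1`, so the rank is zero.
    have hbz : b ^ (k + 1) = 0 := by
      have h0 : Module.finrank ℚ (LinearMap.range (toLin' (b ^ (k + 1))ᵀ)) = 0 := by omega
      rw [Submodule.finrank_eq_zero, LinearMap.range_eq_bot, LinearEquiv.map_eq_zero_iff,
        transpose_eq_zero] at h0
      exact h0
    -- A second missing vertex would give `k + 1 ≤ |U| ≤ |V| - 2 ≤ k`.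
    have hothers : ∀ w, w ≠ s → (∃ x, a w x ≠ 0) ∧ ∃ x, a x w ≠ 0 := by
      intro w hw
      by_contra hw'
      have : Fintype.card U ≤ Fintype.card V - 2 := by
        rw [Fintype.card_subtype, ← Finset.card_pair hw, ← Finset.card_compl]
        refine Finset.card_le_card fun x hx => ?_
        rw [Finset.mem_filter] at hx
        rw [Finset.mem_compl, Finset.mem_insert, Finset.mem_singleton]
        rintro (rfl | rfl)
        · exact hw' hx.2
        · obtain ⟨y, hy⟩ := hx.2.2
          exact hy (hs hx.2.1 y)
      omega
    -- If `s` is not a sink, every vertex has a successor, so no power of `b` has a zero row; `v`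
    -- itself witnesses that `U` is not empty.
    by_cases hsink : ∃ x, a s x ≠ 0
    · obtain ⟨w, hw⟩ := exists_pow_pos_right hb (hex fun w => by
        by_cases hws : w = s
        · exact hws ▸ hsink
        · exact (hothers w hws).1) (k + 1) ⟨v, hv, hvs⟩
      rw [hbz] at hw
      exact lt_irrefl _ hw
    -- If `s` is a sink it is nobody's predecessor, so predecessors stay in `U` and no power of `b`
    -- has a zero column.
    · push Not at hsink
      have hex2 : ∀ u : U, ∃ w : U, 0 < b w u := fun u => by
        obtain ⟨w, hw, hw'⟩ := hpred u
        have hws : w ≠ s := by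
          rintro rfl
          exact hw.ne' (hsink u)
        exact ⟨⟨w, hothers w hws⟩, hw⟩
      obtain ⟨w, hw⟩ := exists_pow_pos_left hb hex2 (k + 1) ⟨v, hv, hvs⟩
      rw [hbz] at hw
      exact lt_irrefl _ hw

end Matrix

end NonnegativeMatrices

/-! ### Semisimplicity of syzygies over a split algebra with radical of square zero. -/

section SplitRadSqZero

/-- An algebra which is a product of copies of the ground field modulo an ideal of square zero. -/
structure SplitRadSqZero (K : Type*) (R : Type*) (V : Type*) [Field K] [Ring R] [Algebra K R]
    [DecidableEq V] where
  /-- The characters through which the algebra acts on its simple modules. -/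
  char : V → R →ₐ[K] K
  /-- The primitive idempotents. -/
  idem : V → R
  -- Orthogonality and completeness of the idempotents are not demanded: the values of the
  -- characters give both modulo the radical, which is enough.
  idem_mul_self : ∀ v, idem v * idem v = idem v
  char_idem : ∀ v w, char w (idem v) = if w = v then 1 else 0
  mul_eq_zero : ∀ x y, (∀ v, char v x = 0) → (∀ v, char v y = 0) → x * y = 0

namespace SplitRadSqZero

variable {K : Type v} {R : Type u} {V : Type w} [Field K] [Ring R] [Algebra K R] [DecidableEq V]
  (D : SplitRadSqZero K R V)

/-- The radical, as a left ideal. -/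
def rad : Ideal R := ⨅ v, RingHom.ker (D.char v)

theorem mem_rad {x : R} : x ∈ D.rad ↔ ∀ v, D.char v x = 0 := by
  simp [rad, Submodule.mem_iInf, RingHom.mem_ker]

theorem rad_mul_right {x : R} (hx : x ∈ D.rad) (r : R) : x * r ∈ D.rad := by
  rw [mem_rad] at hx ⊢
  intro v
  rw [map_mul, hx, zero_mul]

theorem mul_rad {x y : R} (hx : x ∈ D.rad) (hy : y ∈ D.rad) : x * y = 0 :=
  D.mul_eq_zero x y (D.mem_rad.1 hx) (D.mem_rad.1 hy)

theorem char_idem_self (v : V) : D.char v (D.idem v) = 1 := by simp [D.char_idem]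

theorem char_idem_of_ne {v w : V} (h : w ≠ v) : D.char w (D.idem v) = 0 := by
  simp [D.char_idem, h]

theorem sub_sum_idem_mem_rad [Fintype V] (x : R) :
    x - ∑ v, D.idem v * x ∈ D.rad := by
  rw [mem_rad]
  intro v
  simp [D.char_idem]

theorem mul_idem_sub_mem_rad (x : R) (v : V) :
    x * D.idem v - D.char v x • D.idem v ∈ D.rad := by
  rw [mem_rad]
  intro w
  by_cases h : w = v
  · subst h
    simp [D.char_idem]
  · simp [D.char_idem, h]

/-- The quiver of the algebra: the arrows from `v` to `w` are detected by the Peirce components of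
the radical. -/
def HasArrow (v w : V) : Prop := ∃ x ∈ D.rad, D.idem w * x * D.idem v ≠ 0

/-- The maximal ideal annihilating the simple module at `v`. -/
def maxIdeal (v : V) : Ideal R := RingHom.ker (D.char v)

theorem mem_maxIdeal {v : V} {x : R} : x ∈ D.maxIdeal v ↔ D.char v x = 0 := RingHom.mem_ker

theorem maxIdeal_mul_right {v : V} {x : R} (hx : x ∈ D.maxIdeal v) (r : R) :
    x * r ∈ D.maxIdeal v := by
  rw [mem_maxIdeal] at hx ⊢
  rw [map_mul, hx, zero_mul]

theorem rad_le_maxIdeal (v : V) : D.rad ≤ D.maxIdeal v := iInf_le _ v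

instance maxIdeal_isMaximal (v : V) : (D.maxIdeal v).IsMaximal :=
  RingHom.ker_isMaximal_of_surjective (D.char v) fun c => ⟨algebraMap K R c, by simp⟩

instance isSimpleModule_quotient (v : V) : IsSimpleModule R (R ⧸ D.maxIdeal v) :=
  isSimpleModule_iff_isCoatom.2 (Ideal.isMaximal_def.1 (D.maxIdeal_isMaximal v))

theorem smul_quotient_eq_zero {v : V} {r : R} (hr : r ∈ D.maxIdeal v) (x : R ⧸ D.maxIdeal v) :
    r • x = 0 := by
  obtain ⟨x, rfl⟩ := Submodule.Quotient.mk_surjective _ x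
  rw [← Submodule.Quotient.mk_smul, Submodule.Quotient.mk_eq_zero]
  exact D.maxIdeal_mul_right hr x

theorem idem_smul_quotient (v : V) (x : R ⧸ D.maxIdeal v) : D.idem v • x = x := by
  have h : (D.idem v - 1) ∈ D.maxIdeal v := by
    rw [mem_maxIdeal, map_sub, char_idem_self, map_one, sub_self]
  have := D.smul_quotient_eq_zero h x
  rwa [sub_smul, one_smul, sub_eq_zero] at this

theorem idem_smul_quotient_of_ne {v w : V} (h : v ≠ w) (x : R ⧸ D.maxIdeal v) :
    D.idem w • x = 0 :=
  D.smul_quotient_eq_zero (D.mem_maxIdeal.2 (D.char_idem_of_ne h)) x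

theorem rad_smul_eq_zero {P : Type*} [AddCommGroup P] [Module R P] {r : R} (hr : r ∈ D.rad) {x : P}
    (hx : x ∈ D.rad • (⊤ : Submodule R P)) : r • x = 0 := by
  induction hx using Submodule.smul_induction_on' with
  | smul s hs y _ => rw [smul_smul, D.mul_rad hr hs, zero_smul]
  | add y _ z _ hy hz => rw [smul_add, hy, hz, add_zero]

theorem mem_proj {v : V} {x : R} :
    x ∈ LinearMap.range (LinearMap.toSpanSingleton R R (D.idem v)) ↔ x * D.idem v = x := by
  constructor
  · rintro ⟨y, rfl⟩
    rw [LinearMap.toSpanSingleton_apply, smul_eq_mul, mul_assoc, D.idem_mul_self]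
  · intro h
    exact ⟨x, h⟩

section RadicalAnnihilates

variable {N : Type*} [AddCommGroup N] [Module R N]

/-- Modulo the radical, `r * idem v` is the scalar `char v r` times `idem v`, so on a module killed
by the radical `idem v • x` is killed by `maxIdeal v`. -/
theorem exists_linearMap_apply_one (hN : ∀ r ∈ D.rad, ∀ x : N, r • x = 0)
    (v : V) (x : N) :
    ∃ f : (R ⧸ D.maxIdeal v) →ₗ[R] N, f (Submodule.Quotient.mk 1) = D.idem v • x := by
  refine ⟨Submodule.liftQ (D.maxIdeal v) (LinearMap.toSpanSingleton R N (D.idem v • x)) ?_, ?_⟩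
  · intro r hr
    rw [LinearMap.mem_ker, LinearMap.toSpanSingleton_apply, smul_smul]
    refine hN _ ?_ x
    have := D.mul_idem_sub_mem_rad r v
    rwa [D.mem_maxIdeal.1 hr, zero_smul, sub_zero] at this
  · rw [Submodule.liftQ_apply, LinearMap.toSpanSingleton_apply, one_smul]

variable [Fintype V]

theorem sum_idem_smul (hN : ∀ r ∈ D.rad, ∀ x : N, r • x = 0) (x : N) :
    ∑ v, D.idem v • x = x := by
  have h := hN _ (D.sub_sum_idem_mem_rad 1) x
  simp only [mul_one, sub_smul, one_smul, Finset.sum_smul] at h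
  exact (sub_eq_zero.1 h).symm

theorem isSemisimpleModule_of_rad_smul (hN : ∀ r ∈ D.rad, ∀ x : N, r • x = 0) :
    IsSemisimpleModule R N := by
  choose f hf using fun i : V × N => D.exists_linearMap_apply_one hN i.1 i.2
  refine isSemisimpleModule_of_isSemisimpleModule_submodule' (p := fun i => LinearMap.range (f i))
    (fun i => IsSemisimpleModule.range (f i)) ?_
  rw [eq_top_iff]
  rintro x -
  rw [← D.sum_idem_smul hN x]
  exact Submodule.sum_mem _ fun v _ => Submodule.mem_iSup_of_mem (v, x) ⟨_, hf (v, x)⟩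

theorem exists_equiv_of_isSimpleModule (hN : ∀ r ∈ D.rad, ∀ x : N, r • x = 0)
    [IsSimpleModule R N] :
    ∃ v, Nonempty (N ≃ₗ[R] (R ⧸ D.maxIdeal v)) := by
  have := IsSimpleModule.nontrivial R N
  obtain ⟨x, hx⟩ := exists_ne (0 : N)
  obtain ⟨v, -, hv⟩ := Finset.exists_ne_zero_of_sum_ne_zero
    (s := Finset.univ) (f := fun v => D.idem v • x) (by rwa [D.sum_idem_smul hN x])
  obtain ⟨f, hf⟩ := D.exists_linearMap_apply_one hN v x
  have h0 : f ≠ 0 := by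
    rintro rfl
    exact hv hf.symm
  exact ⟨v, ⟨(LinearEquiv.ofBijective f (LinearMap.bijective_of_ne_zero h0)).symm⟩⟩

end RadicalAnnihilates

/-- In the semisimple quotient `P / rad P` the image of the kernel has a complement. Its preimage
together with the superfluous kernel is everything, so the complement is everything and the image is
zero. -/
theorem ker_le_rad_smul [Fintype V] {P M : Type u} [AddCommGroup P] [Module R P] [AddCommGroup M] [Module R M]
    {π : P →ₗ[R] M} (h : IsProjectiveCover π) : LinearMap.ker π ≤ D.rad • (⊤ : Submodule R P) := by
  set J := D.rad • (⊤ : Submodule R P)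
  have hss : IsSemisimpleModule R (P ⧸ J) := D.isSemisimpleModule_of_rad_smul fun r hr x => by
    obtain ⟨x, rfl⟩ := Submodule.Quotient.mk_surjective _ x
    rw [← Submodule.Quotient.mk_smul, Submodule.Quotient.mk_eq_zero]
    exact Submodule.smul_mem_smul hr trivial
  obtain ⟨C, hC⟩ := exists_isCompl ((LinearMap.ker π).map J.mkQ)
  have htop : C.comap J.mkQ ⊔ LinearMap.ker π = ⊤ := by
    rw [eq_top_iff]
    rintro x -
    have hx : J.mkQ x ∈ (LinearMap.ker π).map J.mkQ ⊔ C := by rw [hC.sup_eq_top]; trivial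
    obtain ⟨_, ⟨y, hy, rfl⟩, z, hz, hyz⟩ := Submodule.mem_sup.1 hx
    rw [← sub_add_cancel x y]
    refine Submodule.add_mem_sup ?_ hy
    rw [Submodule.mem_comap, map_sub, ← hyz, add_sub_cancel_left]
    exact hz
  have hcomap := h.superfluous _ htop
  intro x hx
  have hxC : J.mkQ x ∈ C := by
    have : x ∈ C.comap J.mkQ := by rw [hcomap]; trivial
    exact this
  have := Submodule.disjoint_def.1 hC.disjoint _ ⟨x, hx, rfl⟩ hxC
  exact (Submodule.Quotient.mk_eq_zero _).1 this

/-- The simple module at `v`. -/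
def simple (v : V) : FGModuleCat.{u} R := FGModuleCat.of R (R ⧸ D.maxIdeal v)

/-- The idempotent left ideal covering the simple module at `v`. -/
def proj (v : V) : FGModuleCat.{u} R :=
  FGModuleCat.of R (LinearMap.range (LinearMap.toSpanSingleton R R (D.idem v)))

theorem projective_proj (v : V) : Module.Projective R (D.proj v) := by
  refine Module.Projective.of_split
    (LinearMap.range (LinearMap.toSpanSingleton R R (D.idem v))).subtype
    (LinearMap.toSpanSingleton R R (D.idem v)).rangeRestrict ?_
  exact LinearMap.ext fun x => Subtype.ext (D.mem_proj.1 x.2)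

/-- The projection onto the simple module at `v`. -/
def projToSimple (v : V) : D.proj v →ₗ[R] D.simple v :=
  (D.maxIdeal v).mkQ ∘ₗ (LinearMap.range (LinearMap.toSpanSingleton R R (D.idem v))).subtype

theorem projToSimple_surjective (v : V) : Function.Surjective (D.projToSimple v) := by
  intro x
  obtain ⟨x, rfl⟩ := Submodule.Quotient.mk_surjective _ x
  refine ⟨⟨x * D.idem v, x, rfl⟩, ?_⟩
  refine (Submodule.Quotient.eq _).2 ?_
  have h : D.char v (x * D.idem v - x) = 0 := by simp [D.char_idem]
  exact D.mem_maxIdeal.2 h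

theorem mem_ker_projToSimple {v : V} (x : D.proj v) :
    x ∈ LinearMap.ker (D.projToSimple v) ↔ x.1 ∈ D.rad := by
  have h : x ∈ LinearMap.ker (D.projToSimple v) ↔ x.1 ∈ D.maxIdeal v :=
    Submodule.Quotient.mk_eq_zero _
  rw [h, mem_maxIdeal, mem_rad]
  refine ⟨fun hx w => ?_, fun hx => hx v⟩
  by_cases hw : w = v
  · rw [hw, hx]
  · rw [← D.mem_proj.1 x.2, map_mul, D.char_idem_of_ne hw, mul_zero]

/-- Without outgoing arrows the radical of `proj v` is zero, so the simple is projective. -/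
theorem cls_simple_eq_zero [Fintype V] {v : V} (hv : ∀ w, ¬ D.HasArrow v w) :
    StableK₀.cls (D.simple v) = 0 := by
  have hinj : Function.Injective (D.projToSimple v) := by
    rw [← LinearMap.ker_eq_bot, eq_bot_iff]
    intro x hx
    rw [mem_ker_projToSimple] at hx
    have h0 : x.1 = 0 := by
      have h1 : ∀ w, D.idem w * x.1 = 0 := fun w => by
        rw [← D.mem_proj.1 x.2, ← mul_assoc]
        by_contra h
        exact hv w ⟨_, hx, h⟩
      have h2 := D.mul_rad (D.sub_sum_idem_mem_rad 1) hx
      simpa [sub_mul, Finset.sum_mul, h1] using h2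
    exact Subtype.ext h0
  rw [← StableK₀.cls_congr
    (LinearEquiv.ofBijective (D.projToSimple v) ⟨hinj, D.projToSimple_surjective v⟩)]
  exact StableK₀.cls_projective _ (D.projective_proj v)

end SplitRadSqZero

theorem StableK₀.cls_pi {R : Type u} [Ring R] [IsArtinianRing R] {n : ℕ}
    (N : Fin n → Type u) [∀ i, AddCommGroup (N i)] [∀ i, Module R (N i)]
    [∀ i, Module.Finite R (N i)] :
    StableK₀.cls (FGModuleCat.of R (∀ i, N i)) = ∑ i, StableK₀.cls (FGModuleCat.of R (N i)) := by
  induction n with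
  | zero =>
    rw [Finset.univ_eq_empty, Finset.sum_empty]
    exact StableK₀.cls_projective _
      (inferInstanceAs (Module.Projective R (∀ i, N i)))
  | succ n ih =>
    rw [Fin.sum_univ_succ, ← ih]
    exact StableK₀.cls_prod (M := FGModuleCat.of R (∀ i, N i)) (M' := FGModuleCat.of R (N 0))
      (M'' := FGModuleCat.of R (∀ i : Fin n, N i.succ)) (Fin.consLinearEquiv R N).symm

namespace SplitRadSqZero

variable {K : Type v} {R : Type u} {V : Type w} [Field K] [Ring R] [Algebra K R] [DecidableEq V]
  [Fintype V] [IsArtinianRing R] (D : SplitRadSqZero K R V)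

/-- A module annihilated by the radical is a sum of simples, the multiplicity of each of them being
nonzero if and only if its idempotent acts nontrivially. -/
theorem exists_cls_eq_sum {N : FGModuleCat.{u} R} (hN : ∀ r ∈ D.rad, ∀ x : N, r • x = 0) :
    ∃ m : V → ℕ, StableK₀.cls N = ∑ v, m v • StableK₀.cls (D.simple v) ∧
      ∀ v, m v ≠ 0 ↔ ∃ x : N, D.idem v • x ≠ 0 := by
  have := D.isSemisimpleModule_of_rad_smul hN
  obtain ⟨n, S, e, hS⟩ := IsSemisimpleModule.exists_linearEquiv_fin_dfinsupp R N
  have hv : ∀ i, ∃ v, Nonempty (S i ≃ₗ[R] (R ⧸ D.maxIdeal v)) := fun i =>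
    D.exists_equiv_of_isSimpleModule fun r hr x => Subtype.ext (hN r hr x)
  choose c hc using hv
  let e' : N ≃ₗ[R] ∀ i, S i := e.trans (DFinsupp.linearEquivFunOnFintype (R := R))
  refine ⟨fun v => (Finset.univ.filter fun i => c i = v).card, ?_, fun v => ?_⟩
  · rw [StableK₀.cls_congr (N := FGModuleCat.of R (∀ i, S i)) e', StableK₀.cls_pi]
    have : ∀ i, StableK₀.cls (FGModuleCat.of R (S i)) = StableK₀.cls (D.simple (c i)) := fun i =>
      StableK₀.cls_congr (M := FGModuleCat.of R (S i)) (N := D.simple (c i)) (hc i).some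
    simp_rw [this]
    rw [← Finset.sum_fiberwise (s := Finset.univ) (g := c)]
    refine Finset.sum_congr rfl fun v _ => ?_
    rw [← Finset.sum_const]
    exact Finset.sum_congr rfl fun i hi => by rw [(Finset.mem_filter.1 hi).2]
  · rw [Finset.card_ne_zero]
    constructor
    · rintro ⟨i, hi⟩
      obtain rfl := (Finset.mem_filter.1 hi).2
      have : Nontrivial (S i) := IsSimpleModule.nontrivial R (S i)
      obtain ⟨y, hy⟩ := exists_ne (0 : S i)
      refine ⟨y, fun h => hy ?_⟩
      have h1 : D.idem (c i) • y = 0 := Subtype.ext h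
      apply (hc i).some.injective
      rw [← D.idem_smul_quotient (c i) ((hc i).some y), ← map_smul, h1]
    · rintro ⟨x, hx⟩
      have h1 : D.idem v • e' x ≠ 0 := by
        rw [← map_smul]
        exact fun h => hx (e'.map_eq_zero_iff.1 h)
      obtain ⟨i, hi⟩ := Function.ne_iff.1 h1
      refine ⟨i, Finset.mem_filter.2 ⟨Finset.mem_univ i, ?_⟩⟩
      by_contra hne
      apply hi
      apply (hc i).some.injective
      rw [Pi.smul_apply, map_smul, D.idem_smul_quotient_of_ne hne]
      simp

/-- The class of a syzygy is a combination of the simple modules at the vertices which are not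
sources. -/
theorem exists_omegaBar_cls (M : FGModuleCat.{u} R) :
    ∃ m : V → ℤ, (∀ w, (∀ v, ¬ D.HasArrow v w) → m w = 0) ∧
      omegaBar R (StableK₀.cls M) = ∑ v, m v • StableK₀.cls (D.simple v) := by
  obtain ⟨P, π, h, ⟨e⟩⟩ := isSyzygy_syzygy M
  have hker : ∀ x : syzygy M, (e x : P) ∈ D.rad • (⊤ : Submodule R P) := fun x =>
    D.ker_le_rad_smul h (e x).2
  obtain ⟨m, hm, hm'⟩ := D.exists_cls_eq_sum (N := syzygy M) fun r hr x => by
    apply e.injective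
    rw [map_smul, map_zero]
    exact Subtype.ext (D.rad_smul_eq_zero hr (hker x))
  refine ⟨fun v => m v, fun w hw => ?_, ?_⟩
  · by_contra hne
    obtain ⟨x, hx⟩ := (hm' w).1 (fun h => hne (by simp [h]))
    -- At a source, `idem w * s * idem v = 0` for every `v` and every radical `s`. As `1 - ∑ v, idem
    -- v` is in the radical, `idem w * s` itself is zero.
    have hzero : ∀ y ∈ D.rad • (⊤ : Submodule R P), D.idem w • y = 0 := by
      intro y hy
      induction hy using Submodule.smul_induction_on' with
      | smul s hs y _ =>
        rw [smul_smul]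
        have h1 : ∀ v, D.idem w * s * D.idem v = 0 := fun v => by
          by_contra h
          exact hw v ⟨s, hs, h⟩
        have h2 := D.mul_rad (Ideal.mul_mem_left _ (D.idem w) hs) (D.sub_sum_idem_mem_rad 1)
        simp only [mul_one, mul_sub, Finset.mul_sum, h1, Finset.sum_const_zero, sub_zero] at h2
        rw [h2, zero_smul]
      | add y _ z _ hy hz => rw [smul_add, hy, hz, add_zero]
    apply hx
    apply e.injective
    rw [map_smul, map_zero]
    exact Subtype.ext (hzero _ (hker x))
  · rw [omegaBar_cls, hm]
    simp

/-- The kernel of `proj v → simple v` consists of the elements `x * idem v` with `x` in the radical.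
It is killed by the radical, and `idem w` acts nontrivially on it exactly when there is an arrow
from `v` to `w`. -/
theorem exists_omegaBar_simple (v : V) :
    ∃ a : V → ℕ, (∀ w, a w ≠ 0 ↔ D.HasArrow v w) ∧
      omegaBar R (StableK₀.cls (D.simple v)) = ∑ w, a w • StableK₀.cls (D.simple w) := by
  obtain ⟨a, ha, ha'⟩ := D.exists_cls_eq_sum (N := kerFG (D.projToSimple v)) fun r hr x => by
    apply Subtype.ext
    apply Subtype.ext
    exact D.mul_rad hr ((D.mem_ker_projToSimple x.1).1 x.2)
  refine ⟨a, fun w => (ha' w).trans ⟨?_, ?_⟩, ?_⟩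
  · rintro ⟨x, hx⟩
    refine ⟨x.1.1, (D.mem_ker_projToSimple x.1).1 x.2, ?_⟩
    rw [mul_assoc, D.mem_proj.1 x.1.2]
    exact fun h => hx (Subtype.ext (Subtype.ext h))
  · rintro ⟨x, hx, hne⟩
    have hmem : x * D.idem v ∈ LinearMap.range (LinearMap.toSpanSingleton R R (D.idem v)) :=
      ⟨x, rfl⟩
    refine ⟨⟨⟨x * D.idem v, hmem⟩,
      (D.mem_ker_projToSimple ⟨_, hmem⟩).2 (D.rad_mul_right hx _)⟩, fun h => hne ?_⟩
    rw [mul_assoc]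
    exact congrArg (fun z => z.1.1) h
  · rw [omegaBar_cls, cls_syzygy (D.projective_proj v) _ (D.projToSimple_surjective v), ha]

end SplitRadSqZero

end SplitRadSqZero

/-! ### An additive invariant vanishing on projectives, which detects simple summands. -/

section IsotypicMultiplicity

theorem smul_top_prod {R M' M'' : Type*} [Ring R] (I : Ideal R) [AddCommGroup M'] [Module R M']
    [AddCommGroup M''] [Module R M''] :
    (I • ⊤ : Submodule R (M' × M'')) = (I • ⊤ : Submodule R M').prod (I • ⊤) := by
  refine le_antisymm (Submodule.smul_le.2 fun r hr x _ =>
    ⟨Submodule.smul_mem_smul hr trivial, Submodule.smul_mem_smul hr trivial⟩) ?_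
  rintro ⟨x, y⟩ ⟨hx, hy⟩
  have h1 : LinearMap.inl R M' M'' x ∈ (I • ⊤ : Submodule R M').map (LinearMap.inl R M' M'') :=
    ⟨x, hx, rfl⟩
  have h2 : LinearMap.inr R M' M'' y ∈ (I • ⊤ : Submodule R M'').map (LinearMap.inr R M' M'') :=
    ⟨y, hy, rfl⟩
  rw [Submodule.map_smul''] at h1 h2
  have hle : ∀ N : Submodule R (M' × M''), I • N ≤ I • ⊤ := fun N => smul_mono_right I le_top
  have := Submodule.add_mem _ (hle _ h1) (hle _ h2)
  simpa using this

/-- The submodule of the elements annihilated by a two-sided ideal. -/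
def annihilatedBy {R : Type*} [Ring R] (I : Ideal R) [I.IsTwoSided] (M : Type*) [AddCommGroup M]
    [Module R M] : Submodule R M where
  carrier := {x | ∀ r ∈ I, r • x = 0}
  add_mem' := fun {x y} hx hy r hr => by rw [smul_add, hx r hr, hy r hr, add_zero]
  zero_mem' := fun r _ => smul_zero r
  smul_mem' := fun s x hx r hr => by rw [smul_smul, hx _ (I.mul_mem_right s hr)]

variable {R : Type u} [Ring R] (I : Ideal R) [I.IsTwoSided]

/-- The part of the annihilated submodule which lies in `I M`. -/
def annihilatedRad (M : Type*) [AddCommGroup M] [Module R M] : Submodule R M :=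
  annihilatedBy I M ⊓ I • ⊤

theorem mem_annihilatedBy {M : Type*} [AddCommGroup M] [Module R M] {x : M} :
    x ∈ annihilatedBy I M ↔ ∀ r ∈ I, r • x = 0 := Iff.rfl

section

variable {M M' M'' : Type*} [AddCommGroup M] [Module R M] [AddCommGroup M'] [Module R M']
  [AddCommGroup M''] [Module R M'']

theorem map_annihilatedBy (e : M ≃ₗ[R] M') :
    (annihilatedBy I M).map e.toLinearMap = annihilatedBy I M' := by
  ext x
  rw [Submodule.mem_map_equiv, mem_annihilatedBy, mem_annihilatedBy]
  refine forall₂_congr fun r _ => ?_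
  rw [← map_smul, LinearEquiv.map_eq_zero_iff]

theorem annihilatedBy_prod :
    annihilatedBy I (M' × M'') = (annihilatedBy I M').prod (annihilatedBy I M'') := by
  ext x
  simp only [Submodule.mem_prod, mem_annihilatedBy, Prod.ext_iff, Prod.smul_fst, Prod.smul_snd,
    Prod.fst_zero, Prod.snd_zero]
  exact ⟨fun h => ⟨fun r hr => (h r hr).1, fun r hr => (h r hr).2⟩,
    fun h r hr => ⟨h.1 r hr, h.2 r hr⟩⟩

theorem map_annihilatedRad (e : M ≃ₗ[R] M') :
    (annihilatedRad I M).map e.toLinearMap = annihilatedRad I M' := by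
  rw [annihilatedRad, Submodule.map_inf _ e.injective, map_annihilatedBy, Submodule.map_smul'',
    Submodule.map_top, LinearEquiv.range, annihilatedRad]

theorem annihilatedRad_prod :
    annihilatedRad I (M' × M'') = (annihilatedRad I M').prod (annihilatedRad I M'') := by
  rw [annihilatedRad, annihilatedBy_prod, smul_top_prod, Submodule.prod_inf_prod]
  rfl

theorem length_submodule_prod (p : Submodule R M') (q : Submodule R M'') :
    Module.length R (p.prod q) = Module.length R p + Module.length R q := by
  rw [← Module.length_prod]
  exact LinearEquiv.length_eq
    { toFun := fun x => (⟨x.1.1, x.2.1⟩, ⟨x.1.2, x.2.2⟩)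
      map_add' := fun _ _ => rfl
      map_smul' := fun _ _ => rfl
      invFun := fun x => ⟨(x.1.1, x.2.1), x.1.2, x.2.2⟩
      left_inv := fun _ => rfl
      right_inv := fun _ => rfl }

end

/-- An element of a projective killed by `I` has coordinates in `R` killed by `I`, hence lying in
`I`. This is why the multiplicity vanishes on projectives. -/
theorem annihilatedRad_of_projective (hI : annihilatedBy I R ≤ I) (P : Type u) [AddCommGroup P]
    [Module R P] [Module.Projective R P] : annihilatedRad I P = annihilatedBy I P := by
  refine inf_eq_left.2 fun x hx => ?_
  obtain ⟨s, hs⟩ := Module.projective_def.1 (inferInstance : Module.Projective R P)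
  rw [← hs x, Finsupp.linearCombination_apply]
  refine Submodule.sum_mem _ fun p _ => Submodule.smul_mem_smul (hI fun r hr => ?_) trivial
  rw [← Finsupp.smul_apply, ← map_smul, hx r hr, map_zero, Finsupp.zero_apply]

/-- The length of the image of the annihilated submodule in `M / I M`. -/
noncomputable def isotypicMultiplicity (M : FGModuleCat.{u} R) : ℤ :=
  (Module.length R (annihilatedBy I M)).toNat - (Module.length R (annihilatedRad I M)).toNat

theorem isotypicMultiplicity_prod [IsArtinianRing R] {M M' M'' : FGModuleCat.{u} R} (e : M ≃ₗ[R] M' × M'') :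
    isotypicMultiplicity I M = isotypicMultiplicity I M' + isotypicMultiplicity I M'' := by
  have h1 : Module.length R (annihilatedBy I M) =
      Module.length R (annihilatedBy I M') + Module.length R (annihilatedBy I M'') := by
    rw [← length_submodule_prod, ← annihilatedBy_prod, ← map_annihilatedBy I e]
    exact (e.submoduleMap _).length_eq
  have h2 : Module.length R (annihilatedRad I M) =
      Module.length R (annihilatedRad I M') + Module.length R (annihilatedRad I M'') := by
    rw [← length_submodule_prod, ← annihilatedRad_prod, ← map_annihilatedRad I e]
    exact (e.submoduleMap _).length_eq
  rw [isotypicMultiplicity, h1, h2, ENat.toNat_add Module.length_ne_top Module.length_ne_top,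
    ENat.toNat_add Module.length_ne_top Module.length_ne_top, isotypicMultiplicity,
    isotypicMultiplicity]
  push_cast
  ring

theorem isotypicMultiplicity_projective (hI : annihilatedBy I R ≤ I) {P : FGModuleCat.{u} R}
    (hP : Module.Projective R P) : isotypicMultiplicity I P = 0 := by
  rw [isotypicMultiplicity, annihilatedRad_of_projective I hI, sub_self]

variable [IsArtinianRing R]

/-- The isotypic multiplicity as a function on the stable Grothendieck group. -/
noncomputable def StableK₀.multiplicity (hI : annihilatedBy I R ≤ I) : StableK₀ R →+ ℤ :=
  QuotientAddGroup.lift (AddSubgroup.closure (stableRelations R))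
    (FreeAbelianGroup.lift (isotypicMultiplicity I)) (by
      rw [AddSubgroup.closure_le]
      rintro z (⟨M, M', M'', ⟨e⟩, rfl⟩ | ⟨P, hP, rfl⟩)
      · simp [isotypicMultiplicity_prod I e]
      · simp [isotypicMultiplicity_projective I hI hP])

theorem StableK₀.multiplicity_cls (hI : annihilatedBy I R ≤ I) (M : FGModuleCat.{u} R) :
    StableK₀.multiplicity I hI (StableK₀.cls M) = isotypicMultiplicity I M := by
  simp [StableK₀.multiplicity, StableK₀.cls]

end IsotypicMultiplicity

/-! ### The matrix of `Ω` on classes of simples, and the bound on the `φ`-dimension. -/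

namespace SplitRadSqZero

open Matrix

variable {K : Type v} {R : Type u} {V : Type w} [Field K] [Ring R] [Algebra K R] [DecidableEq V]
  (D : SplitRadSqZero K R V)

instance maxIdeal_isTwoSided (v : V) : (D.maxIdeal v).IsTwoSided :=
  ⟨fun r hx => D.maxIdeal_mul_right hx r⟩

/-- Take a nonzero `j = idem w * y * idem v` in the radical. If `maxIdeal v` kills `x`, then `j * x
= 0`; but `j * x = char v x • j` because products of radical elements vanish. So `char v x = 0`. -/
theorem annihilatedBy_maxIdeal_le {v w : V} (h : D.HasArrow v w) :
    annihilatedBy (D.maxIdeal v) R ≤ D.maxIdeal v := by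
  obtain ⟨y, hy, hne⟩ := h
  intro x hx
  have hj : D.idem w * y * D.idem v ∈ D.rad :=
    D.rad_mul_right (Ideal.mul_mem_left _ _ hy) _
  have hmem : D.idem v * x - D.char v x • D.idem v ∈ D.rad := by
    rw [mem_rad]
    intro u
    by_cases hu : u = v
    · subst hu
      simp [D.char_idem]
    · simp [D.char_idem, hu]
  have h1 := hx _ (D.rad_le_maxIdeal v hj)
  have h2 := D.mul_rad hj hmem
  rw [mul_sub, ← mul_assoc, mul_assoc _ (D.idem v) (D.idem v), D.idem_mul_self, ← smul_eq_mul,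
    h1, zero_sub, neg_eq_zero, mul_smul_comm, mul_assoc _ (D.idem v) (D.idem v),
    D.idem_mul_self] at h2
  exact D.mem_maxIdeal.2 ((smul_eq_zero.1 h2).resolve_right hne)

theorem isotypicMultiplicity_simple_self (v : V) :
    isotypicMultiplicity (D.maxIdeal v) (D.simple v) = 1 := by
  have h1 : annihilatedBy (D.maxIdeal v) (R ⧸ D.maxIdeal v) = ⊤ :=
    eq_top_iff.2 fun x _ r hr => D.smul_quotient_eq_zero hr x
  have h2 : annihilatedRad (D.maxIdeal v) (R ⧸ D.maxIdeal v) = ⊥ := by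
    rw [annihilatedRad, eq_bot_iff]
    exact inf_le_right.trans (Submodule.smul_le.2 fun r hr x _ =>
      (Submodule.mem_bot R).2 (D.smul_quotient_eq_zero hr x))
  change ((Module.length R (annihilatedBy (D.maxIdeal v) (R ⧸ D.maxIdeal v))).toNat : ℤ) -
    (Module.length R (annihilatedRad (D.maxIdeal v) (R ⧸ D.maxIdeal v))).toNat = 1
  rw [h1, h2, Module.length_top, Module.length_bot, Module.length_eq_one]
  simp

theorem isotypicMultiplicity_simple_of_ne {v w : V} (h : w ≠ v) :
    isotypicMultiplicity (D.maxIdeal v) (D.simple w) = 0 := by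
  have h1 : annihilatedBy (D.maxIdeal v) (R ⧸ D.maxIdeal w) = ⊥ := by
    refine eq_bot_iff.2 fun x hx => ?_
    rw [Submodule.mem_bot, ← D.idem_smul_quotient w x]
    exact hx _ (D.mem_maxIdeal.2 (D.char_idem_of_ne h.symm))
  have h2 : annihilatedRad (D.maxIdeal v) (R ⧸ D.maxIdeal w) = ⊥ := by
    rw [annihilatedRad, h1, bot_inf_eq]
  change ((Module.length R (annihilatedBy (D.maxIdeal v) (R ⧸ D.maxIdeal w))).toNat : ℤ) -
    (Module.length R (annihilatedRad (D.maxIdeal v) (R ⧸ D.maxIdeal w))).toNat = 0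
  rw [h1, h2, sub_self]

variable [Fintype V]

/-- The linear combination of simple modules with the given coefficients. -/
noncomputable def combination (z : V → ℤ) : StableK₀ R :=
  ∑ v, z v • StableK₀.cls (D.simple v)

variable [IsArtinianRing R]

/-- The multiplicity at a vertex with an outgoing arrow reads off the coefficient there; at a sink
the class is zero, so its coefficient is invisible. -/
theorem combination_eq_zero_iff (z : V → ℤ) :
    D.combination z = 0 ↔ ∀ v, (∃ w, D.HasArrow v w) → z v = 0 := by
  constructor
  · rintro h v ⟨w, hw⟩
    have h1 := congrArg
      (StableK₀.multiplicity (D.maxIdeal v) (D.annihilatedBy_maxIdeal_le hw)) h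
    rw [combination, map_sum, map_zero, Finset.sum_eq_single v] at h1
    · rwa [map_zsmul, StableK₀.multiplicity_cls, D.isotypicMultiplicity_simple_self, smul_eq_mul,
        mul_one] at h1
    · intro u _ hu
      rw [map_zsmul, StableK₀.multiplicity_cls, D.isotypicMultiplicity_simple_of_ne hu, smul_zero]
    · simp
  · intro h
    refine Finset.sum_eq_zero fun v _ => ?_
    by_cases hv : ∃ w, D.HasArrow v w
    · rw [h v hv, zero_smul]
    · rw [D.cls_simple_eq_zero (not_exists.1 hv), smul_zero]

theorem exists_omegaBar_matrix :
    ∃ a : Matrix V V ℕ, (∀ v w, a v w ≠ 0 ↔ D.HasArrow v w) ∧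
      ∀ (l : ℕ) (z : V → ℤ), (omegaBar R)^[l] (D.combination z) =
        D.combination (z ᵥ* (a.map (Nat.cast : ℕ → ℤ)) ^ l) := by
  choose a ha ha' using D.exists_omegaBar_simple
  have h1 : ∀ z : V → ℤ, omegaBar R (D.combination z) =
      D.combination (z ᵥ* (Matrix.of a).map (Nat.cast : ℕ → ℤ)) := by
    intro z
    simp only [combination, map_sum, map_zsmul, ha', Finset.smul_sum, vecMul, dotProduct,
      Finset.sum_smul, Matrix.map_apply, Matrix.of_apply]
    rw [Finset.sum_comm]
    refine Finset.sum_congr rfl fun w _ => Finset.sum_congr rfl fun v _ => ?_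
    rw [mul_smul, natCast_zsmul]
  refine ⟨Matrix.of a, fun v w => ha v w, fun l z => ?_⟩
  induction l with
  | zero => simp
  | succ l ih => rw [Function.iterate_succ_apply', ih, h1, vecMul_vecMul, pow_succ]

theorem exists_omegaBar_eq_combination (x : StableK₀ R) :
    ∃ z : V → ℤ, (∀ w, (∀ v, ¬ D.HasArrow v w) → z w = 0) ∧
      omegaBar R x = D.combination z := by
  obtain ⟨x, rfl⟩ := QuotientAddGroup.mk_surjective x
  induction x using FreeAbelianGroup.induction_on with
  | zero =>
    refine ⟨0, fun _ _ => rfl, ?_⟩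
    rw [QuotientAddGroup.mk_zero, map_zero]
    simp [combination]
  | of M => exact D.exists_omegaBar_cls M
  | neg M h =>
    obtain ⟨z, hz, h⟩ := h
    refine ⟨-z, fun w hw => by simp [hz w hw], ?_⟩
    rw [QuotientAddGroup.mk_neg, map_neg, h]
    simp [combination]
  | add x y hx hy =>
    obtain ⟨z, hz, hx⟩ := hx
    obtain ⟨z', hz', hy⟩ := hy
    refine ⟨z + z', fun w hw => by simp [hz w hw, hz' w hw], ?_⟩
    rw [QuotientAddGroup.mk_add, map_add, hx, hy]
    simp [combination, add_smul, Finset.sum_add_distrib]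

/-- If the quiver is not strongly connected, the `φ`-dimension is smaller than the number of
vertices. -/
theorem phiDim_lt_card {S : Set V} {p q : V} (hp : p ∈ S) (hq : q ∉ S)
    (hS : ∀ v w, D.HasArrow v w → v ∈ S → w ∈ S) : phiDim R < (Fintype.card V : ℕ∞) := by
  have hcard : 2 ≤ Fintype.card V := by
    have hne : p ≠ q := fun h => hq (h ▸ hp)
    have := Fintype.one_lt_card_iff.2 ⟨p, q, hne⟩
    omega
  obtain ⟨n, hn⟩ := Nat.exists_eq_add_of_le hcard
  obtain ⟨a, ha, homega⟩ := D.exists_omegaBar_matrix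
  have key : ∀ (s : ℕ) (x : StableK₀ R), (omegaBar R)^[n + 1 + s + 1] x = 0 →
      (omegaBar R)^[n + 1 + s] x = 0 := by
    intro s x hx
    obtain ⟨z, hz, hxz⟩ := D.exists_omegaBar_eq_combination x
    -- One `Ω` is spent on reaching combinations of simples. The remaining `n + s` steps meet the
    -- bound of the matrix lemma, as the number of vertices is `2 + n`.
    rw [show n + 1 + s = n + s + 1 by omega, Function.iterate_succ_apply, hxz, homega,
      combination_eq_zero_iff] at hx ⊢
    -- The rank argument takes place over `ℚ`.
    have hcast : ∀ (l : ℕ) (v : V), (((z ᵥ* (a.map (Nat.cast : ℕ → ℤ)) ^ l) v : ℤ) : ℚ) =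
        ((fun v => (z v : ℚ)) ᵥ* (a.map (Nat.cast : ℕ → ℚ)) ^ l) v := by
      intro l v
      have h1 := RingHom.map_vecMul (Int.castRingHom ℚ) ((a.map (Nat.cast : ℕ → ℤ)) ^ l) z v
      rw [Matrix.map_pow] at h1
      simpa [Matrix.map_map, Function.comp_def] using h1
    have hne : ∀ v w, (a.map (Nat.cast : ℕ → ℚ)) v w ≠ 0 ↔ D.HasArrow v w := fun v w => by
      rw [Matrix.map_apply, Nat.cast_ne_zero, ha]
    intro v hv
    have := vecMul_pow_eq_zero_of_succ (a := a.map (Nat.cast : ℕ → ℚ)) (z := fun v => (z v : ℚ))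
      (k := n + s) (fun u v => Nat.cast_nonneg _) hp hq
      (fun u v h => hS u v ((hne u v).1 h)) (by omega)
      (fun w hw => by
        rw [hz w fun v h => (hne v w).2 h (hw v), Int.cast_zero])
      (fun v hv => by
        rw [← hcast, hx v (hv.imp fun w h => (hne v w).1 h), Int.cast_zero])
      (v := v) (hv.imp fun w h => (hne v w).2 h)
    rw [← hcast] at this
    exact_mod_cast this
  refine lt_of_le_of_lt (b := ((n + 1 : ℕ) : ℕ∞)) (iSup_le fun M => ?_) ?_
  -- The level `n + 1` is one less than the number of vertices. Injectivity holds on the whole image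
  -- of the iterate, so `add M` plays no role.
  · refine iInf₂_le (n + 1) fun s => ?_
    rintro _ ⟨x, -, rfl⟩ _ ⟨y, -, rfl⟩ hxy
    rw [← Function.iterate_succ_apply' (omegaBar R), ← Function.iterate_succ_apply' (omegaBar R),
      ← sub_eq_zero, ← iterate_map_sub] at hxy
    rw [← sub_eq_zero, ← iterate_map_sub]
    exact key s _ hxy
  · rw [Nat.cast_lt]
    omega

end SplitRadSqZero

/-! ### The opposite of `KQ / J²` as a split algebra with radical of square zero. -/

section PathAlgebraCharacters

open Quiver

variable {K : Type u} [Field K] {V : Type v} [Quiver.{w} V]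

namespace PathAlgebra

/-- A concatenation is trivial only if both factors are, so taking the coefficient of a trivial path
is multiplicative. -/
theorem pathMul_apply_nil {a : V} (f g : Path a a →₀ K) :
    pathMul K a a a f g Path.nil = f Path.nil * g Path.nil := by
  induction f using Finsupp.induction_linear with
  | zero => simp
  | add f f' hf hf' => simp [hf, hf', add_mul]
  | single p r =>
    induction g using Finsupp.induction_linear with
    | zero => simp
    | add g g' hg hg' => simp [hg, hg', mul_add]
    | single q s =>
      classical
      rw [pathMul_single, Finsupp.single_apply, Finsupp.single_apply, Finsupp.single_apply]
      by_cases hq : q = Path.nil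
      · subst hq
        by_cases hp : p = Path.nil <;> simp [hp]
      · have : p.comp q ≠ Path.nil := fun h => hq <| Path.eq_nil_of_length_zero q <| by
          have := congrArg Path.length h
          rw [Path.length_comp, Path.length_nil] at this
          omega
        rw [if_neg this, if_neg hq, mul_zero]

theorem pathMul_apply_nil_of_ne {a b : V} (hab : b ≠ a) (f : Path a b →₀ K) (g : Path b a →₀ K) :
    pathMul K a b a f g Path.nil = 0 := by
  induction f using Finsupp.induction_linear with
  | zero => simp
  | add f f' hf hf' => simp [hf, hf']
  | single p r =>
    induction g using Finsupp.induction_linear with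
    | zero => simp
    | add g g' hg hg' => simp [hg, hg']
    | single q s =>
      classical
      rw [pathMul_single, Finsupp.single_apply, if_neg]
      intro h
      have := congrArg Path.length h
      rw [Path.length_comp, Path.length_nil] at this
      exact hab (Path.eq_of_length_zero p (by omega)).symm

theorem eq_sum_incl [Fintype V] (f : PathAlgebra K V) :
    f = ∑ a, ∑ b, incl a b (f a b) := by
  classical
  have h : ∀ a, ∑ b, incl a b (f a b) =
      (LinearMap.single K (fun a : V => ∀ b : V, Path a b →₀ K) a (f a) : PathAlgebra K V) := by
    intro a
    have h' : ∑ b, LinearMap.single K (fun b : V => Path a b →₀ K) b (f a b) = f a :=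
      Finset.univ_sum_single (f a)
    conv_rhs => rw [← h']
    exact (map_sum (LinearMap.single K (fun a : V => ∀ b : V, Path a b →₀ K) a)
      _ Finset.univ).symm
  simp_rw [h]
  exact (Finset.univ_sum_single (M := fun a : V => ∀ b : V, Path a b →₀ K) f).symm

theorem incl_mem {S : Submodule K (PathAlgebra K V)} {a b : V} {g : Path a b →₀ K}
    (h : ∀ p, g p ≠ 0 → ofPath p ∈ S) : incl a b g ∈ S := by
  rw [← Finsupp.sum_single g, Finsupp.sum, map_sum]
  refine S.sum_mem fun p hp => ?_
  have : (Finsupp.single p (g p) : Path a b →₀ K) = g p • Finsupp.single p 1 := by simp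
  rw [this, map_smul]
  exact S.smul_mem _ (h p (Finsupp.mem_support_iff.1 hp))

theorem incl_apply_self {a b : V} (g : Path a b →₀ K) : incl a b g a b = g := by
  classical
  rw [incl_apply, Pi.single_eq_same, Pi.single_eq_same]

theorem incl_apply_of_ne {a b x y : V} (g : Path a b →₀ K) (h : ¬ (x = a ∧ y = b)) :
    incl a b g x y = 0 := by
  classical
  rw [incl_apply]
  by_cases hx : x = a
  · subst hx
    rw [Pi.single_eq_same, Pi.single_eq_of_ne fun hy => h ⟨rfl, hy⟩]
  · rw [Pi.single_eq_of_ne hx]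
    rfl

variable [Fintype V]

theorem idem_mul_mul_idem (f : PathAlgebra K V) (v w : V) :
    ofPath (Path.nil : Path v v) * f * ofPath (Path.nil : Path w w) = incl v w (f v w) := by
  funext x y
  rw [mul_apply, Finset.sum_eq_single w]
  · rw [mul_apply, Finset.sum_eq_single v]
    · simp only [ofPath]
      by_cases hx : x = v
      · subst hx
        by_cases hy : y = w
        · subst hy
          rw [incl_apply_self, incl_apply_self, incl_apply_self, nil_pathMul, pathMul_nil]
        · rw [incl_apply_of_ne _ fun h => hy h.2, incl_apply_of_ne _ fun h => hy h.2, map_zero]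
      · rw [incl_apply_of_ne _ fun h => hx h.1, incl_apply_of_ne _ fun h => hx h.1]
        simp
    · intro z _ hz
      rw [ofPath, incl_apply_of_ne _ fun h => hz h.2]
      simp
    · simp
  · intro z _ hz
    rw [ofPath, ofPath, incl_apply_of_ne _ fun h => hz h.1, map_zero]
  · simp

/-- The coefficient of the trivial path at a vertex. -/
noncomputable def vertexChar (v : V) : PathAlgebra K V →ₐ[K] K :=
  AlgHom.ofLinearMap
    { toFun := fun f => f v v Path.nil
      map_add' := fun _ _ => rfl
      map_smul' := fun _ _ => rfl }
    (by
      classical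
      change (1 : PathAlgebra K V) v v Path.nil = 1
      rw [one_apply, Pi.single_eq_same, Finsupp.single_eq_same])
    (fun f g => by
      change (f * g) v v Path.nil = f v v Path.nil * g v v Path.nil
      rw [mul_apply, Finsupp.finsetSum_apply, Finset.sum_eq_single v]
      · exact pathMul_apply_nil _ _
      · exact fun b _ hb => pathMul_apply_nil_of_ne hb _ _
      · simp)

theorem vertexChar_apply (v : V) (f : PathAlgebra K V) : vertexChar v f = f v v Path.nil := rfl

theorem vertexChar_ofPath_of_length_pos (v : V) {a b : V} (p : Path a b) (hp : 0 < p.length) :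
    vertexChar v (ofPath p : PathAlgebra K V) = 0 := by
  classical
  rw [vertexChar_apply, ofPath]
  by_cases h : v = a ∧ v = b
  · obtain ⟨rfl, rfl⟩ := h
    rw [incl_apply_self, Finsupp.single_apply, if_neg]
    rintro rfl
    simp at hp
  · rw [incl_apply_of_ne _ h, Finsupp.zero_apply]

theorem vertexChar_eq_zero_of_mem (v : V) {f : PathAlgebra K V}
    (hf : f ∈ (arrowIdeal K V).asIdeal) : vertexChar v f = 0 := by
  have h : arrowIdeal K V ≤ TwoSidedIdeal.ker (vertexChar (K := K) v) := by
    refine TwoSidedIdeal.span_le.2 ?_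
    rintro _ ⟨a, b, α, rfl⟩
    exact (TwoSidedIdeal.mem_ker _).2
      (vertexChar_ofPath_of_length_pos v α.toPath (by simp))
  exact (TwoSidedIdeal.mem_ker _).1 (h (TwoSidedIdeal.mem_asIdeal.1 hf))

theorem ofPath_mem_arrowIdeal {a b : V} (p : Path a b) (hp : 0 < p.length) :
    (ofPath p : PathAlgebra K V) ∈ (arrowIdeal K V).asIdeal := by
  cases p with
  | nil => simp at hp
  | cons p α =>
    have : (ofPath (p.cons α) : PathAlgebra K V) = ofPath p * ofPath α.toPath := by
      rw [RadSqZero.pathAlgebra_ofPath_mul]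
      rfl
    rw [this]
    exact Ideal.mul_mem_left _ _
      (TwoSidedIdeal.mem_asIdeal.2 (TwoSidedIdeal.subset_span ⟨_, _, α, rfl⟩))

theorem length_pos_of_apply_ne_zero {f : PathAlgebra K V} (hf : ∀ v, vertexChar v f = 0) {a b : V}
    {p : Path a b} (hp : f a b p ≠ 0) : 0 < p.length := by
  cases p with
  | nil => exact absurd (hf a) hp
  | cons p α => simp

/-- Both sides describe the span of the paths of positive length. This identifies `J` with the
common kernel of the characters. -/
theorem mem_arrowIdeal_iff {f : PathAlgebra K V} :
    f ∈ (arrowIdeal K V).asIdeal ↔ ∀ v, vertexChar v f = 0 := by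
  refine ⟨fun h v => vertexChar_eq_zero_of_mem v h, fun h => ?_⟩
  rw [eq_sum_incl f]
  exact Ideal.sum_mem _ fun a _ => Ideal.sum_mem _ fun b _ =>
    incl_mem (S := (arrowIdeal K V).asIdeal.restrictScalars K) fun p hp =>
      ofPath_mem_arrowIdeal p (length_pos_of_apply_ne_zero h hp)

end PathAlgebra

namespace RadSqZero

variable [Fintype V]

/-- The character of `KQ / J²` at a vertex. -/
noncomputable def vertexChar (v : V) : RadSqZero K V →ₐ[K] K :=
  Ideal.Quotient.liftₐ _ (PathAlgebra.vertexChar v) fun _ h =>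
    PathAlgebra.vertexChar_eq_zero_of_mem v (Ideal.mul_le_left h)

theorem vertexChar_mk (v : V) (f : PathAlgebra K V) :
    vertexChar v (Ideal.Quotient.mk _ f : RadSqZero K V) = PathAlgebra.vertexChar v f := rfl

open MulOpposite in
variable (K V) in
/-- The opposite of `KQ / J²`, with its characters and trivial paths. -/
noncomputable def splitRadSqZero [DecidableEq V] : SplitRadSqZero K (RadSqZero K V)ᵐᵒᵖ V where
  char v := AlgHom.fromOpposite (vertexChar v) fun _ _ => Commute.all _ _
  idem v := op (ofPath K V (Path.nil : Path v v))
  idem_mul_self v := by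
    rw [← op_mul, ofPath, ← map_mul, pathAlgebra_ofPath_mul, Path.comp_nil]
  char_idem v w := by
    change PathAlgebra.vertexChar w (PathAlgebra.ofPath (Path.nil : Path v v)) = _
    rw [PathAlgebra.vertexChar_apply, PathAlgebra.ofPath]
    split_ifs with h
    · subst h
      rw [PathAlgebra.incl_apply_self, Finsupp.single_eq_same]
    · rw [PathAlgebra.incl_apply_of_ne _ fun h' => h h'.1, Finsupp.zero_apply]
  mul_eq_zero x y hx hy := by
    apply unop_injective
    rw [unop_mul, unop_zero]
    obtain ⟨f, hf⟩ := Ideal.Quotient.mk_surjective x.unop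
    obtain ⟨g, hg⟩ := Ideal.Quotient.mk_surjective y.unop
    have hf' : f ∈ (PathAlgebra.arrowIdeal K V).asIdeal :=
      PathAlgebra.mem_arrowIdeal_iff.2 fun v => by
        rw [← vertexChar_mk, hf]
        exact hx v
    have hg' : g ∈ (PathAlgebra.arrowIdeal K V).asIdeal :=
      PathAlgebra.mem_arrowIdeal_iff.2 fun v => by
        rw [← vertexChar_mk, hg]
        exact hy v
    rw [← hf, ← hg, ← map_mul, Ideal.Quotient.eq_zero_iff_mem]
    exact Ideal.mul_mem_mul hg' hf'

/-- The Peirce component of an element of `J` is a combination of paths from `v` to `w` of positive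
length. Without an arrow all of them have length at least two and die modulo `J²`. -/
theorem nonempty_hom_of_hasArrow [DecidableEq V] {v w : V}
    (h : (splitRadSqZero K V).HasArrow v w) : Nonempty (v ⟶ w) := by
  obtain ⟨x, hx, hne⟩ := h
  rw [SplitRadSqZero.mem_rad] at hx
  obtain ⟨f, hf⟩ := Ideal.Quotient.mk_surjective x.unop
  have hf' : ∀ u, PathAlgebra.vertexChar u f = 0 := fun u => by
    rw [← vertexChar_mk, hf]
    exact hx u
  by_contra hvw
  apply hne
  apply MulOpposite.unop_injective
  rw [MulOpposite.unop_mul, MulOpposite.unop_mul, MulOpposite.unop_zero, ← hf]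
  -- Passing to the opposite ring reverses the product, which puts `v` on the left as the source.
  change Ideal.Quotient.mk _ (PathAlgebra.ofPath (Path.nil : Path v v) *
    (f * PathAlgebra.ofPath (Path.nil : Path w w))) = 0
  rw [← mul_assoc (PathAlgebra.ofPath _ : PathAlgebra K V), PathAlgebra.idem_mul_mul_idem,
    Ideal.Quotient.eq_zero_iff_mem]
  refine PathAlgebra.incl_mem (S := ((PathAlgebra.arrowIdeal K V).asIdeal *
    (PathAlgebra.arrowIdeal K V).asIdeal).restrictScalars K) fun p hp => ?_
  refine Ideal.Quotient.eq_zero_iff_mem.1 (ofPath_eq_zero K V p ?_)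
  have hpos := PathAlgebra.length_pos_of_apply_ne_zero hf' hp
  by_contra hlt
  cases p with
  | nil => simp at hpos
  | cons p α =>
    cases p with
    | nil => exact hvw ⟨α⟩
    | cons p β => simp at hlt

theorem phiDim_lt_card_of_not_isStronglyConnected [∀ a b : V, Finite (a ⟶ b)]
    (h : ¬ Quiver.IsStronglyConnected V) :
    phiDim (RadSqZero K V)ᵐᵒᵖ < (Fintype.card V : ℕ∞) := by
  classical
  simp only [Quiver.IsStronglyConnected, not_forall] at h
  obtain ⟨a, b, hab⟩ := h
  -- The closed set is that of the vertices reachable from `a`, which misses `b`.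
  refine (splitRadSqZero K V).phiDim_lt_card (S := {c | Nonempty (Path a c)}) (p := a) (q := b)
    ⟨Path.nil⟩ hab ?_
  rintro v w hvw ⟨p⟩
  obtain ⟨α⟩ := nonempty_hom_of_hasArrow hvw
  exact ⟨p.cons α⟩

end RadSqZero

end PathAlgebraCharacters

/-! ### Closed sets of vertices in a strongly connected quiver. -/

section Subhearts

variable {V : Type v} [Quiver.{w} V]

theorem Quiver.IsStronglyConnected.eq_univ_of_closed_successors
    (h : Quiver.IsStronglyConnected V) {S : Set V} (hne : S.Nonempty)
    (hS : ∀ a b : V, Nonempty (a ⟶ b) → a ∈ S → b ∈ S) : S = Set.univ := by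
  obtain ⟨a, ha⟩ := hne
  refine Set.eq_univ_of_forall fun b => ?_
  obtain ⟨p⟩ := h a b
  induction p with
  | nil => exact ha
  | cons p α ih => exact hS _ _ ⟨α⟩ ih

theorem Quiver.IsStronglyConnected.eq_univ_of_closed_predecessors
    (h : Quiver.IsStronglyConnected V) {S : Set V} (hne : S.Nonempty)
    (hS : ∀ a b : V, Nonempty (a ⟶ b) → b ∈ S → a ∈ S) : S = Set.univ := by
  by_contra hu
  -- The complement of a set closed under predecessors is closed under successors.
  have hc : Sᶜ = Set.univ := h.eq_univ_of_closed_successors (Set.nonempty_compl.2 hu)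
    fun a b hab ha hb => ha (hS a b hab hb)
  obtain ⟨a, ha⟩ := hne
  exact (hc ▸ Set.mem_univ a : a ∈ Sᶜ) ha

end Subhearts

theorem corollary4p27 (K : Type u) [Field K] (Q : Type v) [Quiver.{w} Q] [Fintype Q]
    [∀ a b : Q, Finite (a ⟶ b)] :
    (phiDim (RadSqZero K Q)ᵐᵒᵖ = (Fintype.card Q : ℕ∞) → Quiver.IsStronglyConnected Q) ∧
    (member K Q = ∅ →
      (∃ S : Set Q, S ≠ Set.univ ∧ (IsFinalSubheart S ∨ IsInitialSubheart S)) →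
      phiDim (RadSqZero K Q)ᵐᵒᵖ < (Fintype.card Q : ℕ∞)) := by
  refine ⟨fun h => ?_, fun _ ⟨S, hS, hS'⟩ => ?_⟩
  · by_contra hsc
    exact (RadSqZero.phiDim_lt_card_of_not_isStronglyConnected hsc).ne h
  · refine RadSqZero.phiDim_lt_card_of_not_isStronglyConnected fun hsc => hS ?_
    rcases hS' with hS' | hS'
    · exact hsc.eq_univ_of_closed_successors hS'.prop.1 hS'.prop.2
    · exact hsc.eq_univ_of_closed_predecessors hS'.prop.1 hS'.prop.2
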